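/- \textbf{Setting.} A set system consists of $S_1,\dots,S_m\subseteq\mathcal U$. For a list $P$ of sets let $\mathrm{new}_P(S)=|S\setminus\bigcup_{S'\in P}S'|$; a greedy choice after $P$ is a set $G$ of the system maximizing $\mathrm{new}_P$. An ordering $s_1,\dots,s_m$ of the system is \emph{$(\alpha,\beta)$-prefix optimal} if there are reals $\alpha_1,\dots,\alpha_m$ with $\frac1i\sum_{j\le i}\alpha_j\ge\alpha$ and $\mathrm{new}_{(s_1,\dots,s_{i-1})}(s_i)\ge\alpha_i\cdot\mathrm{new}_{(s_1,\dots,s_{i-1})}(G)-\beta$ for every $i$ and every greedy choice $G$ after $s_1,\dots,s_{i-1}$. $\mathrm{Lap}(b)$ has density $e^{-|x|/b}/(2b)$; all random draws below are fresh and independent. \textbf{DP-MaNIS} (size parameter $n$, privacy parameter $\epsilon'$, sets $A$, elements $B$; constants $C_1,C_2$). Write $N(a)$ for the elements of $a$, and put $\delta=\epsilon'/(C_1\log n)$, $A^{(0)}=A$, $B^{(0)}=B$, $\tilde D(a)=|N(a)\cap B|+\mathrm{Lap}(2/\delta)$. For $r=0,\dots,\lceil C_2\log n\rceil$: draw $x_a$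 uniformly from $[0,1]$; for $b\in B^{(r)}$ let $\varphi(b)$ be the set $a\in A^{(r)}$ containing $b$ with largest $x_a$; let \[J^{(r)}=\{a\in A^{(r)}:|\{b\in B^{(r)}:\varphi(b)=a\}|+\mathrm{Lap}(1/\delta)\ge(1-4\eta)\tilde D(a)\},\] $B^{(r+1)}=B^{(r)}\setminus\bigcup_{a\in J^{(r)}}N(a)$, and \[A^{(r+1)}=\Bigl\{a\in A^{(r)}\setminus J^{(r)}:|N(a)\cap B^{(r+1)}|+\mathrm{Lap}(1/\delta)\ge(1-\eta)\tilde D(a)+\tfrac{6\log n}{(1-3\eta)\delta}\Bigr\}.\] Output $J^{(0)},J^{(1)},\dots$ concatenated, each sorted by decreasing $x_a$. \textbf{Algorithm 2} (size parameter $n$, privacy parameter $\epsilon$; constants $C_1,C_2,K$). Let $T=\lceil\log_{1/(1-\eta)}n\rceil$, $\epsilon_0=\epsilon/(2T)$, $\mathcal U_T=\mathcal U$, and let $\mathcal S_T$ be the whole system. For $t=T,\dots,1$: let $\mathcal A_t$ be the sets $S\in\mathcal S_t$ for which \[\frac1{(1-\eta)^{t-1}}-\frac{K\log^2n}{\epsilon_0}\le|S\cap\mathcal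 U_t|+\mathrm{Lap}(1/\epsilon_0)\le\frac1{(1-\eta)^t}+\frac{K\log^2n}{\epsilon_0};\] let $J_t$ be the output of DP-MaNIS on $(\mathcal A_t,\mathcal U_t)$ with privacy parameter $\epsilon_0$; let $\mathcal U_{t-1}=\mathcal U_t\setminus\bigcup_{S\in J_t}S$ and $\mathcal S_{t-1}=\mathcal S_t\setminus J_t$. Output the concatenation of $J_T,\dots,J_1,\mathcal S_0$ (with $\mathcal S_0$ in index order). \textbf{Theorem.} Let $0<\eta<1/3$ and $k\in\mathbb N$. For every sufficiently large $C_2$ (depending on $\eta,k$), every $C_1>0$ and every sufficiently large $K$ (depending on $\eta,k,C_1,C_2$), there are constants $c,C>0$ and $d\in\mathbb N$, depending only on $\eta,k,C_1,C_2,K$, such that for all $n\ge2$, all set systems with $|\mathcal U|\le n$ and $m\le n^k$, and all $\epsilon>0$, with probability at least $1-C\log^d(n)/n^2$ the output of Algorithm 2 is an ordering of the set system that is $(1-5\eta,\;c\log^2n/\epsilon_0)$-prefix optimal; in fact, each output set covers at least $(1-5\eta)$ times the new coverage of the greedy choice, minus $c\log^2n/\epsilon_0$. -/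

import Mathlib

open MeasureTheory

namespace DPCover

/-- The Laplace distribution `Lap(b)` on `ℝ`, with density `exp (-|x| / b) / (2 b)`. -/
noncomputable def laplace (b : ℝ) : Measure ℝ :=
  volume.withDensity fun x => ENNReal.ofReal (Real.exp (-|x| / b) / (2 * b))

/-- The uniform distribution on `[0, 1]`. -/
noncomputable def uniform01 : Measure ℝ := volume.restrict (Set.Icc 0 1)

/-! ### The private nearly independent set procedure

A set system with `m` sets over a universe of `N` elements is a map
`S : Fin m → Finset (Fin N)`.  Randomized algorithms are deterministic functions of the tape of
all their random draws, and the tape is distributed according to a product measure. -/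

/-- The draws of one round: for every set index `a`, the priority `x_a`, the noise in the
selection test and the noise in the survival test. -/
abbrev RoundTape (m : ℕ) : Type := Fin m → ℝ × ℝ × ℝ

/-- The draws of a call with `R` rounds: the noise of the degree estimates, then the rounds. -/
abbrev ManisTape (m R : ℕ) : Type := (Fin m → ℝ) × (Fin R → RoundTape m)

/-- The loop state: remaining sets `A`, remaining elements `B`, and the sets chosen so far. -/
structure ManisState (m N : ℕ) where
  A : Finset (Fin m)
  B : Finset (Fin N)
  out : List (Fin m)

open Classical in
/-- The elements `b ∈ B` that pick `a`: among the sets of `A` containing `b`, the set `a` has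
the largest priority (priorities are almost surely distinct). -/
noncomputable def picks {m N : ℕ} (S : Fin m → Finset (Fin N)) (A : Finset (Fin m))
    (B : Finset (Fin N)) (x : Fin m → ℝ) (a : Fin m) : Finset (Fin N) :=
  B.filter fun b => b ∈ S a ∧ ∀ a' ∈ A, b ∈ S a' → x a' ≤ x a

open Classical in
/-- The elements of `J` listed in decreasing order of priority. -/
noncomputable def sortByPriority {m : ℕ} (x : Fin m → ℝ) (J : Finset (Fin m)) : List (Fin m) :=
  ((List.finRange m).filter fun a => a ∈ J).insertionSort fun a a' => x a' ≤ x a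

open Classical in
/-- One round.  `deg` are the noisy degree estimates made at the start of the call, and `θ` is
the additive offset of the survival test. -/
noncomputable def manisStep {m N : ℕ} (S : Fin m → Finset (Fin N)) (η θ : ℝ) (deg : Fin m → ℝ)
    (s : ManisState m N) (ω : RoundTape m) : ManisState m N :=
  let x : Fin m → ℝ := fun a => (ω a).1
  let J : Finset (Fin m) := s.A.filter fun a =>
    ((picks S s.A s.B x a).card : ℝ) + (ω a).2.1 ≥ (1 - 4 * η) * deg a
  let B' : Finset (Fin N) := s.B \ J.biUnion S
  let A' : Finset (Fin m) := (s.A \ J).filter fun a =>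
    (((S a ∩ s.B) ∩ B').card : ℝ) + (ω a).2.2 ≥ (1 - η) * deg a + θ
  { A := A', B := B', out := s.out ++ sortByPriority x J }

/-- The per-query privacy parameter `ε / (C₁ log n)` inside a call with privacy parameter `ε`. -/
noncomputable def manisEps (n : ℕ) (C₁ ε : ℝ) : ℝ := ε / (C₁ * Real.log n)

/-- The number of rounds `t = 0, …, ⌈C₂ log n⌉`. -/
noncomputable def manisRounds (n : ℕ) (C₂ : ℝ) : ℕ := ⌈C₂ * Real.log n⌉₊ + 1

/-- The private nearly independent set procedure, run with privacy parameter `ε` on the universe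
`B` and the sets `S a ∩ B`, `a ∈ A`; the result is the ordered list of chosen sets. -/
noncomputable def manis {m N R : ℕ} (S : Fin m → Finset (Fin N)) (n : ℕ) (η C₁ ε : ℝ)
    (A : Finset (Fin m)) (B : Finset (Fin N)) (ω : ManisTape m R) : List (Fin m) :=
  let deg : Fin m → ℝ := fun a => ((S a ∩ B).card : ℝ) + ω.1 a
  let θ : ℝ := 6 * Real.log n / ((1 - 3 * η) * manisEps n C₁ ε)
  ((List.ofFn ω.2).foldl (manisStep S η θ deg) { A := A, B := B, out := [] }).out

/-- The joint law of the (independent) draws of a call: degree noise `Lap(2/ε')`, priorities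
uniform in `[0, 1]`, all the other noise `Lap(1/ε')`, where `ε'` is the per-query parameter. -/
noncomputable def manisLaw (m R n : ℕ) (C₁ ε : ℝ) : Measure (ManisTape m R) :=
  (Measure.pi fun _ : Fin m => laplace (2 / manisEps n C₁ ε)).prod
    (Measure.pi fun _ : Fin R => Measure.pi fun _ : Fin m =>
      uniform01.prod ((laplace (1 / manisEps n C₁ ε)).prod (laplace (1 / manisEps n C₁ ε))))

/-! ### The private coverage algorithm -/

/-- The number of phases, `log_{1/(1-η)} n` rounded up. -/
noncomputable def phases (n : ℕ) (η : ℝ) : ℕ := ⌈Real.logb (1 / (1 - η)) n⌉₊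

/-- `ε₀ = ε / (2 T)`, where `T` is the number of phases. -/
noncomputable def eps0 (n : ℕ) (η ε : ℝ) : ℝ := ε / (2 * (phases n η : ℝ))

/-- The draws of the algorithm: in each phase, one noise value per set for the bucket test, and
the draws of the call to the nearly independent set procedure. -/
abbrev CoverTape (m T R : ℕ) : Type := Fin T → (Fin m → ℝ) × ManisTape m R

/-- The loop state: uncovered elements `U`, remaining sets, and the sets output so far. -/
structure CoverState (m N : ℕ) where
  U : Finset (Fin N)
  rem : Finset (Fin m)
  out : List (Fin m)

open Classical in
/-- The phase with index `t`, `1 ≤ t ≤ T`. -/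
noncomputable def coverStep {m N R : ℕ} (S : Fin m → Finset (Fin N)) (n : ℕ)
    (η C₁ K ε : ℝ) (t : ℕ) (ω : (Fin m → ℝ) × ManisTape m R) (s : CoverState m N) :
    CoverState m N :=
  let ε₀ : ℝ := eps0 n η ε
  let bucket : Finset (Fin m) := s.rem.filter fun a =>
    1 / (1 - η) ^ (t - 1) - K * Real.log n ^ 2 / ε₀ ≤ ((S a ∩ s.U).card : ℝ) + ω.1 a ∧
    ((S a ∩ s.U).card : ℝ) + ω.1 a ≤ 1 / (1 - η) ^ t + K * Real.log n ^ 2 / ε₀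
  let J : List (Fin m) := manis S n η C₁ ε₀ bucket s.U ω.2
  { U := s.U \ J.toFinset.biUnion S, rem := s.rem \ J.toFinset, out := s.out ++ J }

open Classical in
/-- The output of the algorithm: the phases `t = T, …, 1` are run in this order, and the sets
that were never chosen are appended at the end. -/
noncomputable def coverOutput {m N T R : ℕ} (S : Fin m → Finset (Fin N)) (n : ℕ)
    (η C₁ K ε : ℝ) (ω : CoverTape m T R) : List (Fin m) :=
  let s : CoverState m N := (List.finRange T).reverse.foldl
    (fun s i => coverStep S n η C₁ K ε (i.val + 1) (ω i) s)
    { U := Finset.univ, rem := Finset.univ, out := [] }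
  s.out ++ (List.finRange m).filter fun a => a ∈ s.rem

/-- The joint law of the (independent) draws of the algorithm: the bucket noise is `Lap(1/ε₀)`,
and the nearly independent set procedure is called with privacy parameter `ε₀`. -/
noncomputable def coverLaw (m n : ℕ) (η C₁ C₂ ε : ℝ) :
    Measure (CoverTape m (phases n η) (manisRounds n C₂)) :=
  Measure.pi fun _ : Fin (phases n η) =>
    (Measure.pi fun _ : Fin m => laplace (1 / eps0 n η ε)).prod
      (manisLaw m (manisRounds n C₂) n C₁ (eps0 n η ε))

/-! ### Prefix optimality -/

/-- The number of elements of the set `a` not covered by the sets listed in `P`. -/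
def newCoverage {m N : ℕ} (S : Fin m → Finset (Fin N)) (P : List (Fin m)) (a : Fin m) : ℕ :=
  (S a \ P.toFinset.biUnion S).card

/-- `g` is a possible greedy choice after the sets listed in `P`. -/
def IsGreedyChoice {m N : ℕ} (S : Fin m → Finset (Fin N)) (P : List (Fin m)) (g : Fin m) :
    Prop :=
  ∀ a, newCoverage S P a ≤ newCoverage S P g

/-- The list `l` of sets is `(α, β)`-prefix optimal: for some real numbers `c 0, c 1, …` all of
whose running averages are at least `α`, each entry `l[i]` covers at least `c i` times as many
new elements as the greedy choice after `l[0], …, l[i-1]`, minus `β`. -/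
def IsPrefixOptimal {m N : ℕ} (S : Fin m → Finset (Fin N)) (α β : ℝ) (l : List (Fin m)) : Prop :=
  ∃ c : ℕ → ℝ, ∀ (i : ℕ) (hi : i < l.length),
    α ≤ (∑ j ∈ Finset.range (i + 1), c j) / ((i : ℝ) + 1) ∧
    ∀ g, IsGreedyChoice S (l.take i) g →
      (newCoverage S (l.take i) l[i] : ℝ) ≥ c i * (newCoverage S (l.take i) g : ℝ) - β

end DPCover

/-! All randomness is confined to one event, `GoodDraws`: every Laplace draw is at most `z` in
absolute value, the priorities of each round are distinct, and every call of DP-MaNIS ends with no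
edge, that is, with no surviving element in a surviving set. On this event the guarantee is
deterministic.

Deterministic part. An element that picks `a` lies in no active set of higher priority. As the
chosen sets are sorted by decreasing priority, the elements picking `a` are still new when `a` is
output, and the selection test makes them a fraction `1 - 4η` of what `a` contained at the start of
the call, up to noise (`ManisCoverage.step`). A set that is dropped failed the survival test, so it
has lost a fraction `η` up to `3z`; a set that is never dropped or chosen has no element left,
because no edge is left. Hence phase `t` turns the bound `(1-η)^(-t) + w` on all remaining sets into
`(1-η)^(-(t-1)) + w` with the same `w`, as soon as `3z ≤ ηw` (`coverStep_card_le_pow`). The sets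
chosen in phase `t` had size at least about `(1-η)^(-(t-1))`, the greedy choice covers at most
`(1-η)^(-t) + w`, and `(1-4η)(1-η) ≥ 1-5η` (`coverStep_prefixAll`).

Probabilistic part. Large noise is excluded by Laplace tails and a union bound. For the edges, each
round removes at least a fraction `decayRate η` of them in expectation, whatever the degree
estimates are (`decayRate_mul_card_le`). A set below the survival threshold disappears with
probability at least `1/2`. For a set `a` above it, take an element `b` of `a`, contained in `d`
active sets, such that few elements of `a` lie in more than `d` active sets. With probability of
order `η/d`, `a` is the only set around `b` with priority above `1 - η/(2d)`; given this, Markov's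
inequality shows that `a` keeps almost all its elements with probability at least `1/2`, and is then
selected. For fixed `b` these events are disjoint, and each deletes all `d` edges at `b`, which
cancels the factor `1/d`. Rounds use fresh draws, so the decay multiplies, and about `C₂ log n`
rounds bring the expected number of edges from at most `n^(k+1)` to at most `n^(-2)`.

For `η ≥ 1/5` the coefficient `1 - 5η` is not positive and the claim is trivial. -/

namespace DPCover

/-! ### Product measures -/

section Product

variable {ι α : Type*} [Fintype ι] [MeasurableSpace α]

lemma measure_pi_eval_preimage (μ : ι → Measure α) [∀ i, IsProbabilityMeasure (μ i)] (i : ι)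
    {E : Set α} (hE : MeasurableSet E) : Measure.pi μ {ω | ω i ∈ E} = μ i E :=
  (measurePreserving_eval μ i).measure_preimage hE.nullMeasurableSet

lemma measureReal_pi_univ_pi (μ : ι → Measure α) [∀ i, IsProbabilityMeasure (μ i)]
    (s : ι → Set α) : (Measure.pi μ).real (Set.univ.pi s) = ∏ i, (μ i).real (s i) := by
  simp [measureReal_def, Measure.pi_pi, ENNReal.toReal_prod]

variable [DecidableEq ι]

/-- Resampling one coordinate of a product measure does not change it. -/
lemma measurePreserving_update (μ : ι → Measure α) [∀ i, IsProbabilityMeasure (μ i)] (i : ι) :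
    MeasurePreserving (fun p : (ι → α) × α => Function.update p.1 i p.2)
      ((Measure.pi μ).prod (μ i)) (Measure.pi μ) := by
  have hm : Measurable fun p : (ι → α) × α => Function.update p.1 i p.2 := by
    refine measurable_pi_iff.2 fun j => ?_
    by_cases h : j = i
    · subst h; simpa using measurable_snd
    · simp only [Function.update_of_ne h]
      exact (measurable_pi_apply j).comp measurable_fst
  refine ⟨hm, (Measure.pi_eq fun s hs => ?_).symm⟩
  rw [Measure.map_apply hm (MeasurableSet.univ_pi hs)]
  -- The old value of coordinate `i` is forgotten, so the preimage of a box is a box with that side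
  -- freed, times the side `s i` for the new value.
  have : (fun p : (ι → α) × α => Function.update p.1 i p.2) ⁻¹' Set.univ.pi s =
      Set.univ.pi (Function.update s i Set.univ) ×ˢ s i := by
    ext ⟨ω, y⟩
    simp only [Set.mem_preimage, Set.mem_univ_pi, Set.mem_prod]
    constructor
    · intro h
      refine ⟨fun j => ?_, by simpa using h i⟩
      by_cases hj : j = i
      · subst hj; simp
      · simpa [hj] using h j
    · rintro ⟨h, hi⟩ j
      by_cases hj : j = i
      · subst hj; simpa using hi
      · simpa [hj] using h j
  rw [this, Measure.prod_prod, Measure.pi_pi, ← Finset.mul_prod_erase _ _ (Finset.mem_univ i),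
    ← Finset.mul_prod_erase Finset.univ (fun j => μ j (s j)) (Finset.mem_univ i)]
  simp only [Function.update_self, measure_univ, one_mul]
  rw [mul_comm]
  congr 1
  refine Finset.prod_congr rfl fun j hj => ?_
  rw [Function.update_of_ne (Finset.ne_of_mem_erase hj)]

/-- A state not depending on coordinate `i` is independent of that coordinate. -/
lemma lintegral_pi_of_update {σ : Type*} [MeasurableSpace σ] (μ : ι → Measure α)
    [∀ i, IsProbabilityMeasure (μ i)] (i : ι) {f : (ι → α) → σ} (hf : Measurable f)
    (hfi : ∀ ω y, f (Function.update ω i y) = f ω) {g : σ × α → ENNReal} (hg : Measurable g) :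
    ∫⁻ ω, g (f ω, ω i) ∂Measure.pi μ = ∫⁻ ω, ∫⁻ y, g (f ω, y) ∂μ i ∂Measure.pi μ := by
  have h1 : Measurable fun ω : ι → α => g (f ω, ω i) :=
    hg.comp (hf.prodMk (measurable_pi_apply i))
  rw [← (measurePreserving_update μ i).lintegral_comp h1]
  simp only [hfi, Function.update_self]
  rw [lintegral_prod]
  exact (hg.comp ((hf.comp measurable_fst).prodMk measurable_snd)).aemeasurable

/-- How fresh draws are used throughout: `f` is the state computed from the other draws, and a
failure bound for the new draw that is uniform in the state survives averaging over the state. -/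
lemma measure_pi_of_update_le {σ : Type*} [MeasurableSpace σ] (μ : ι → Measure α)
    [∀ i, IsProbabilityMeasure (μ i)] (i : ι) {f : (ι → α) → σ} (hf : Measurable f)
    (hfi : ∀ ω y, f (Function.update ω i y) = f ω) {E : Set (σ × α)} (hE : MeasurableSet E)
    {p : ENNReal} (hp : ∀ s, μ i {y | (s, y) ∈ E} ≤ p) :
    Measure.pi μ {ω | (f ω, ω i) ∈ E} ≤ p := by
  have h := lintegral_pi_of_update μ i hf hfi (measurable_const.indicator hE :
    Measurable (E.indicator fun _ => (1 : ENNReal)))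
  have hm : MeasurableSet {ω | (f ω, ω i) ∈ E} :=
    (hf.prodMk (measurable_pi_apply i)) hE
  have e1 : ∫⁻ ω, E.indicator (fun _ => (1 : ENNReal)) (f ω, ω i) ∂Measure.pi μ =
      Measure.pi μ {ω | (f ω, ω i) ∈ E} := by
    rw [← lintegral_indicator_one hm]; rfl
  rw [← e1, h]
  calc _ ≤ ∫⁻ _, p ∂Measure.pi μ := by
        refine lintegral_mono fun ω => le_trans (le_of_eq ?_) (hp (f ω))
        have : MeasurableSet {y | (f ω, y) ∈ E} := measurable_prodMk_left hE
        rw [← lintegral_indicator_one this]; rfl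
    _ = p := by simp

lemma measure_prod_le_of_slice_le {β : Type*} [MeasurableSpace β] (μ : Measure α)
    [IsProbabilityMeasure μ] (ν : Measure β) [SFinite ν] {E : Set (α × β)} (hE : MeasurableSet E)
    {p : ENNReal} (hp : ∀ x, ν {y | (x, y) ∈ E} ≤ p) : μ.prod ν E ≤ p := by
  rw [Measure.prod_apply hE]
  calc _ ≤ ∫⁻ _, p ∂μ := lintegral_mono hp
    _ = p := by simp

end Product

/-- Markov's inequality for the number of events of a finite family that occur. -/
lemma mul_measureReal_card_le {α κ : Type*} [MeasurableSpace α] (μ : Measure α)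
    [IsFiniteMeasure μ] (I : Finset κ) (E : κ → Set α) (hE : ∀ i ∈ I, MeasurableSet (E i))
    (F : Set α) {t : ℝ} (ht : 0 ≤ t) :
    open Classical in
    t * μ.real (F ∩ {ω | t ≤ ((I.filter fun i => ω ∈ E i).card : ℝ)}) ≤
      ∑ i ∈ I, μ.real (F ∩ E i) := by
  classical
  have hc : ∀ ω, ((I.filter fun i => ω ∈ E i).card : ENNReal) =
      ∑ i ∈ I, (E i).indicator (fun _ => (1 : ENNReal)) ω := by
    intro ω
    rw [Finset.card_filter, Nat.cast_sum]
    simp [Set.indicator_apply]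
  have hm : Measurable fun ω => ∑ i ∈ I, (E i).indicator (fun _ => (1 : ENNReal)) ω :=
    Finset.measurable_sum _ fun i hi => measurable_const.indicator (hE i hi)
  have h := mul_meas_ge_le_lintegral (μ := μ.restrict F) hm (ENNReal.ofReal t)
  rw [lintegral_finsetSum _ fun i hi => measurable_const.indicator (hE i hi)] at h
  have h2 : ∀ i ∈ I, ∫⁻ ω in F, (E i).indicator (fun _ => (1 : ENNReal)) ω ∂μ = μ (F ∩ E i) := by
    intro i hi
    have := lintegral_indicator_one (μ := μ.restrict F) (hE i hi)
    rw [Measure.restrict_apply (hE i hi), Set.inter_comm] at this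
    exact this
  rw [Finset.sum_congr rfl h2] at h
  have h3 : MeasurableSet {x | ENNReal.ofReal t ≤
      ∑ i ∈ I, (E i).indicator (fun _ => (1 : ENNReal)) x} := measurableSet_le measurable_const hm
  rw [Measure.restrict_apply h3, Set.inter_comm] at h
  have h4 : {x | ENNReal.ofReal t ≤ ∑ i ∈ I, (E i).indicator (fun _ => (1 : ENNReal)) x} =
      {ω | t ≤ ((I.filter fun i => ω ∈ E i).card : ℝ)} := by
    ext ω
    rw [Set.mem_ofPred_eq, ← hc ω, Set.mem_ofPred_eq, ENNReal.ofReal_le_iff_le_toReal (by simp)]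
    simp
  rw [h4] at h
  have h5 := ENNReal.toReal_mono (by simp [ENNReal.sum_eq_top]) h
  rwa [ENNReal.toReal_mul, ENNReal.toReal_ofReal ht, ENNReal.toReal_sum (by simp)] at h5

/-! ### The Laplace and uniform distributions -/

lemma laplace_Ioi {b : ℝ} (hb : 0 < b) {t : ℝ} (ht : 0 ≤ t) :
    laplace b (Set.Ioi t) = ENNReal.ofReal (Real.exp (-t / b) / 2) := by
  have ha : -1 / b < 0 := div_neg_of_neg_of_pos (by norm_num) hb
  rw [laplace, withDensity_apply _ measurableSet_Ioi]
  have h1 : ∫⁻ x in Set.Ioi t, ENNReal.ofReal (Real.exp (-|x| / b) / (2 * b)) =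
      ∫⁻ x in Set.Ioi t, ENNReal.ofReal (Real.exp (-1 / b * x) / (2 * b)) := by
    refine setLIntegral_congr_fun measurableSet_Ioi fun x hx => ?_
    have : 0 ≤ x := ht.trans (le_of_lt hx)
    simp only [abs_of_nonneg this]
    ring_nf
  rw [h1, ← ofReal_integral_eq_lintegral_ofReal
    ((integrableOn_exp_mul_Ioi ha t).div_const _)
    (Filter.Eventually.of_forall fun x => by positivity),
    integral_div, integral_exp_mul_Ioi ha t]
  congr 1
  rw [show -1 / b * t = -t / b by ring]
  field_simp

lemma laplace_Iio_neg {b : ℝ} (hb : 0 < b) {t : ℝ} (ht : 0 ≤ t) :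
    laplace b (Set.Iio (-t)) = ENNReal.ofReal (Real.exp (-t / b) / 2) := by
  rw [← laplace_Ioi hb ht, laplace, withDensity_apply _ measurableSet_Ioi,
    withDensity_apply _ measurableSet_Iio, ← lintegral_indicator measurableSet_Ioi,
    ← lintegral_indicator measurableSet_Iio, ← lintegral_neg_eq_self]
  congr 1
  ext x
  simp only [Set.indicator_apply, Set.mem_Iio, Set.mem_Ioi, neg_lt_neg_iff, abs_neg]

lemma laplace_singleton (b x : ℝ) : laplace b {x} = 0 :=
  withDensity_absolutelyContinuous _ _ (by simp)

lemma isProbabilityMeasure_laplace {b : ℝ} (hb : 0 < b) : IsProbabilityMeasure (laplace b) := by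
  constructor
  have h : (Set.univ : Set ℝ) = Set.Iio (-0) ∪ ({0} ∪ Set.Ioi 0) := by
    ext x; rcases lt_trichotomy x 0 with h | h | h <;> simp [h]
  rw [h, measure_union (by simp) (by measurability),
    measure_union (by simp) measurableSet_Ioi, laplace_singleton, laplace_Ioi hb le_rfl,
    laplace_Iio_neg hb le_rfl, zero_add, ← ENNReal.ofReal_add (by positivity) (by positivity)]
  norm_num

lemma laplace_abs_gt_le {b : ℝ} (hb : 0 < b) {t : ℝ} (ht : 0 ≤ t) :
    laplace b {x | t < |x|} ≤ ENNReal.ofReal (Real.exp (-t / b)) := by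
  have h : {x : ℝ | t < |x|} ⊆ Set.Iio (-t) ∪ Set.Ioi t := by
    intro x hx
    rcases lt_abs.1 (show t < |x| from hx) with h | h
    · exact Or.inr h
    · exact Or.inl (by simpa using lt_neg.1 h)
  refine (measure_mono h).trans ((measure_union_le _ _).trans ?_)
  rw [laplace_Ioi hb ht, laplace_Iio_neg hb ht, ← ENNReal.ofReal_add (by positivity) (by positivity)]
  simp

lemma half_le_laplace_Ici {b : ℝ} (hb : 0 < b) : 1 / 2 ≤ (laplace b).real (Set.Ici 0) := by
  have := isProbabilityMeasure_laplace hb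
  refine le_trans (le_of_eq ?_) (measureReal_mono (Set.Ioi_subset_Ici_self))
  rw [measureReal_def, laplace_Ioi hb le_rfl, ENNReal.toReal_ofReal (by positivity)]
  simp

lemma half_le_laplace_Iic {b : ℝ} (hb : 0 < b) : 1 / 2 ≤ (laplace b).real (Set.Iic 0) := by
  have := isProbabilityMeasure_laplace hb
  have h : Set.Iio (-0 : ℝ) ⊆ Set.Iic 0 := by simp
  refine le_trans (le_of_eq ?_) (measureReal_mono h)
  rw [measureReal_def, laplace_Iio_neg hb le_rfl, ENNReal.toReal_ofReal (by positivity)]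
  simp

instance : IsProbabilityMeasure uniform01 := ⟨by simp [uniform01]⟩

lemma uniform01_Ici {τ : ℝ} (h0 : 0 ≤ τ) (h1 : τ ≤ 1) :
    uniform01.real (Set.Ici τ) = 1 - τ := by
  have : Set.Ici τ ∩ Set.Icc 0 1 = Set.Icc τ 1 := by
    ext x; simp only [Set.mem_inter_iff, Set.mem_Ici, Set.mem_Icc]
    constructor
    · rintro ⟨a, b, c⟩; exact ⟨a, c⟩
    · rintro ⟨a, b⟩; exact ⟨a, h0.trans a, b⟩
  rw [measureReal_def, uniform01, Measure.restrict_apply measurableSet_Ici, this, Real.volume_Icc,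
    ENNReal.toReal_ofReal (by linarith)]

lemma uniform01_Iio {τ : ℝ} (h0 : 0 ≤ τ) (h1 : τ ≤ 1) : uniform01.real (Set.Iio τ) = τ := by
  have h := probReal_compl_eq_one_sub (μ := uniform01) (measurableSet_Ici (a := τ))
  rw [uniform01_Ici h0 h1, Set.compl_Ici] at h
  linarith

lemma uniform01_singleton (x : ℝ) : uniform01 {x} = 0 :=
  le_antisymm ((Measure.restrict_apply_le _ _).trans (by simp)) zero_le

/-! ### Measurability of the algorithms -/

/-- All state spaces are discrete, and the two kinds of loop state are countable, so joint
measurability in state and draws only has to be checked for each fixed state. -/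
instance finsetMeasurableSpace {κ : Type*} : MeasurableSpace (Finset κ) := ⊤

instance {κ : Type*} : DiscreteMeasurableSpace (Finset κ) := ⟨fun _ => trivial⟩

instance listMeasurableSpace {κ : Type*} : MeasurableSpace (List κ) := ⊤

instance {κ : Type*} : DiscreteMeasurableSpace (List κ) := ⟨fun _ => trivial⟩

instance manisStateMeasurableSpace {m N : ℕ} : MeasurableSpace (ManisState m N) := ⊤

instance {m N : ℕ} : DiscreteMeasurableSpace (ManisState m N) := ⟨fun _ => trivial⟩

instance {m N : ℕ} : Countable (ManisState m N) :=
  Function.Injective.countable (f := fun s : ManisState m N => (s.A, s.B, s.out)) fun s t h => by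
    cases s; cases t; simpa using h

instance coverStateMeasurableSpace {m N : ℕ} : MeasurableSpace (CoverState m N) := ⊤

instance {m N : ℕ} : DiscreteMeasurableSpace (CoverState m N) := ⟨fun _ => trivial⟩

instance {m N : ℕ} : Countable (CoverState m N) :=
  Function.Injective.countable (f := fun s : CoverState m N => (s.U, s.rem, s.out)) fun s t h => by
    cases s; cases t; simpa using h

section

variable {Z : Type*} [MeasurableSpace Z]

lemma measurable_finset_filter {κ : Type*} [Countable κ] (s : Finset κ) {p : Z → κ → Prop}
    [∀ z, DecidablePred (p z)]
    (hp : ∀ i ∈ s, Measurable fun z => p z i) : Measurable fun z => s.filter (p z) := by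
  refine measurable_to_countable' fun T => ?_
  classical
  by_cases hT : T ⊆ s
  · have : (fun z => s.filter (p z)) ⁻¹' {T} = ⋂ i ∈ s, {z | p z i ↔ i ∈ T} := by
      ext z
      simp only [Set.mem_preimage, Set.mem_singleton_iff, Set.mem_iInter, Set.mem_ofPred_eq,
        Finset.ext_iff, Finset.mem_filter]
      constructor
      · intro h i hi
        rw [← h i]; simp [hi]
      · intro h i
        constructor
        · rintro ⟨hi, hpi⟩; exact (h i hi).1 hpi
        · intro hi; exact ⟨hT hi, (h i (hT hi)).2 hi⟩
    rw [this]
    refine Finset.measurableSet_biInter _ fun i hi => ?_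
    exact measurableSet_setOfPred.2 ((hp i hi).iff measurable_const)
  · convert MeasurableSet.empty
    ext z
    simp only [Set.mem_preimage, Set.mem_singleton_iff, Set.mem_empty_iff_false, iff_false]
    rintro rfl
    exact hT (Finset.filter_subset _ _)

variable {m N : ℕ} {x : Z → Fin m → ℝ}

lemma measurable_picks (S : Fin m → Finset (Fin N)) (A : Finset (Fin m)) (B : Finset (Fin N))
    (hx : ∀ a, Measurable fun z => x z a) (a : Fin m) :
    Measurable fun z => picks S A B (x z) a := by
  have h : ∀ b, Measurable fun z => b ∈ S a ∧ ∀ a' ∈ A, b ∈ S a' → x z a' ≤ x z a := by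
    intro b
    refine Measurable.and (p := fun _ : Z => b ∈ S a) measurable_const ?_
    refine Measurable.forall fun a' => Measurable.imp (p := fun _ : Z => a' ∈ A) measurable_const ?_
    refine Measurable.imp (p := fun _ : Z => b ∈ S a') measurable_const ?_
    exact measurableSet_setOfPred.1 (measurableSet_le (hx a') (hx a))
  exact measurable_finset_filter B fun b _ => h b

-- The priorities enter only through finitely many comparisons, so sorting factors through a
-- discrete space.
open Classical in
lemma measurable_sortByPriority {J : Z → Finset (Fin m)}
    (hx : ∀ a, Measurable fun z => x z a) (hJ : Measurable J) :
    Measurable fun z => sortByPriority (x z) (J z) := by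
  have hr : Measurable fun z => fun a a' : Fin m => x z a' ≤ x z a :=
    measurable_pi_iff.2 fun a => measurable_pi_iff.2 fun a' =>
      measurableSet_setOfPred.1 (measurableSet_le (hx a') (hx a))
  have hF : Measurable fun p : (Fin m → Fin m → Prop) × Finset (Fin m) =>
      ((List.finRange m).filter fun a => a ∈ p.2).insertionSort p.1 := Measurable.of_discrete
  convert hF.comp (hr.prodMk hJ) using 2
  simp only [sortByPriority, Function.comp]

lemma measurable_manisStep_of_state (S : Fin m → Finset (Fin N)) (η θ : ℝ)
    {deg : Z → Fin m → ℝ} (t : ManisState m N) {ω : Z → RoundTape m} (hd : Measurable deg)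
    (hω : Measurable ω) : Measurable fun z => manisStep S η θ (deg z) t (ω z) := by
  classical
  have hda : ∀ a, Measurable fun z => deg z a := measurable_pi_iff.1 hd
  have hωa : ∀ a, Measurable fun z => ω z a := measurable_pi_iff.1 hω
  have hx : ∀ a, Measurable fun z => (ω z a).1 := fun a => (hωa a).fst
  have hcard : ∀ {κ : Type} {f : Z → Finset κ}, Measurable f →
      Measurable fun z => ((f z).card : ℝ) := fun hf =>
    (Measurable.of_discrete (f := fun T : Finset _ => (T.card : ℝ))).comp hf
  have hJ : Measurable fun z => t.A.filter fun a =>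
      ((picks S t.A t.B (fun a => (ω z a).1) a).card : ℝ) + (ω z a).2.1 ≥
        (1 - 4 * η) * deg z a :=
    measurable_finset_filter _ fun a _ => measurableSet_setOfPred.1 <|
      measurableSet_le ((hda a).const_mul _)
        ((hcard (measurable_picks S t.A t.B hx a)).add (hωa a).snd.fst)
  set J := fun z => t.A.filter fun a =>
      ((picks S t.A t.B (fun a => (ω z a).1) a).card : ℝ) + (ω z a).2.1 ≥
        (1 - 4 * η) * deg z a with hJdef
  have hB : Measurable fun z => t.B \ (J z).biUnion S :=
    (Measurable.of_discrete (f := fun J : Finset (Fin m) => t.B \ J.biUnion S)).comp hJ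
  have hA : Measurable fun z => (t.A \ J z).filter fun a =>
      (((S a ∩ t.B) ∩ (t.B \ (J z).biUnion S)).card : ℝ) + (ω z a).2.2 ≥
        (1 - η) * deg z a + θ := by
    -- The base set of this filter is random; moving `J` into the predicate leaves the fixed base
    -- `t.A`.
    have : (fun z => (t.A \ J z).filter fun a =>
      (((S a ∩ t.B) ∩ (t.B \ (J z).biUnion S)).card : ℝ) + (ω z a).2.2 ≥
        (1 - η) * deg z a + θ) = fun z => t.A.filter fun a => a ∉ J z ∧
      (((S a ∩ t.B) ∩ (t.B \ (J z).biUnion S)).card : ℝ) + (ω z a).2.2 ≥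
        (1 - η) * deg z a + θ := by
      ext z a
      simp only [Finset.mem_filter, Finset.mem_sdiff, and_assoc]
    rw [this]
    have h : ∀ a, Measurable fun z => a ∉ J z ∧
        (((S a ∩ t.B) ∩ (t.B \ (J z).biUnion S)).card : ℝ) + (ω z a).2.2 ≥
          (1 - η) * deg z a + θ := by
      intro a
      refine Measurable.and (p := fun z => a ∉ J z) ?_ ?_
      · exact (Measurable.of_discrete (f := fun T : Finset (Fin m) => a ∉ T)).comp hJ
      · refine measurableSet_setOfPred.1 <| measurableSet_le (((hda a).const_mul _).add_const _)
          (Measurable.add ?_ (hωa a).snd.snd)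
        exact (Measurable.of_discrete (f := fun T : Finset (Fin N) =>
          (((S a ∩ t.B) ∩ T).card : ℝ))).comp hB
    exact measurable_finset_filter t.A fun a _ => h a
  have ho : Measurable fun z => t.out ++ sortByPriority (fun a => (ω z a).1) (J z) :=
    (Measurable.of_discrete (f := fun l : List (Fin m) => t.out ++ l)).comp
      (measurable_sortByPriority hx hJ)
  have hF : Measurable fun p : Finset (Fin m) × Finset (Fin N) × List (Fin m) =>
      (⟨p.1, p.2.1, p.2.2⟩ : ManisState m N) := Measurable.of_discrete
  exact hF.comp (hA.prodMk (hB.prodMk ho))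

lemma measurable_manisStep (S : Fin m → Finset (Fin N)) (η θ : ℝ) {deg : Z → Fin m → ℝ}
    {s : Z → ManisState m N} {ω : Z → RoundTape m} (hd : Measurable deg) (hs : Measurable s)
    (hω : Measurable ω) : Measurable fun z => manisStep S η θ (deg z) (s z) (ω z) := by
  have hj : Measurable fun p : ManisState m N × (Fin m → ℝ) × RoundTape m =>
      manisStep S η θ p.2.1 p.1 p.2.2 := by
    refine measurable_from_prod_countable_right fun t => ?_
    exact measurable_manisStep_of_state S η θ (deg := Prod.fst) (ω := Prod.snd) t
      measurable_fst measurable_snd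
  have hc := hj.comp (hs.prodMk (hd.prodMk hω))
  exact hc

end

/-! ### The expected number of edges removed in one round -/

/-- The law of the draws of one round, with noise of scale `β`. -/
noncomputable def roundLaw (m : ℕ) (β : ℝ) : Measure (RoundTape m) :=
  Measure.pi fun _ : Fin m => uniform01.prod ((laplace β).prod (laplace β))

/-- The sets of `A` that contain `b`. -/
def covering {m N : ℕ} (S : Fin m → Finset (Fin N)) (A : Finset (Fin m)) (b : Fin N) :
    Finset (Fin m) := A.filter fun a => b ∈ S a

/-- The pairs of a set of `A` and an element of `B` contained in it. -/
def edges {m N : ℕ} (S : Fin m → Finset (Fin N)) (A : Finset (Fin m)) (B : Finset (Fin N)) :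
    Finset (Fin m × Fin N) := (A ×ˢ B).filter fun e => e.2 ∈ S e.1

/-- At least a fraction `η` of the elements of `X` are exceeded in `f` by at most `η |X|` others. -/
lemma mul_card_le_card_filter_exceeded {κ : Type*} (X : Finset κ) (f : κ → ℕ) {η : ℝ}
    (hη : η ≤ 1) :
    open Classical in
    η * X.card ≤ (X.filter fun b =>
      ((X.filter fun b' => f b < f b').card : ℝ) ≤ η * X.card).card := by
  classical
  set G := X.filter fun b => ((X.filter fun b' => f b < f b').card : ℝ) ≤ η * X.card with hG
  by_cases h : (X \ G).Nonempty
  -- Take `b` with the largest value outside `G`. More than `η |X|` elements exceed it, and by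
  -- maximality all of them lie in `G`.
  · obtain ⟨b, hb, hmax⟩ := Finset.exists_max_image (X \ G) f h
    rw [Finset.mem_sdiff] at hb
    have hb2 : η * X.card < ((X.filter fun b' => f b < f b').card : ℝ) := by
      by_contra hc
      exact hb.2 (Finset.mem_filter.2 ⟨hb.1, not_lt.1 hc⟩)
    refine hb2.le.trans ?_
    have : X.filter (fun b' => f b < f b') ⊆ G := by
      intro b' hb'
      rw [Finset.mem_filter] at hb'
      by_contra hc
      exact absurd (hmax b' (Finset.mem_sdiff.2 ⟨hb'.1, hc⟩)) (not_le.2 hb'.2)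
    exact_mod_cast Finset.card_le_card this
  · have : X = G := by
      refine Finset.Subset.antisymm ?_ (Finset.filter_subset _ _)
      rwa [← Finset.sdiff_eq_empty_iff_subset, ← Finset.not_nonempty_iff_eq_empty]
    rw [← this]
    nlinarith [(Nat.cast_nonneg X.card : (0 : ℝ) ≤ X.card)]

section

variable {m N : ℕ} (S : Fin m → Finset (Fin N)) {β : ℝ}

lemma isProbabilityMeasure_roundLaw (m : ℕ) (hβ : 0 < β) :
    IsProbabilityMeasure (roundLaw m β) := by
  have := isProbabilityMeasure_laplace hβ
  unfold roundLaw; infer_instance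

open Classical in
/-- The event that `a` alone has priority at least `τ` among the sets of `C`, and its selection
noise is nonnegative. -/
def leadEvent (C : Finset (Fin m)) (τ : ℝ) (a : Fin m) : Set (RoundTape m) :=
  Set.univ.pi fun j => if j = a then Set.Ici τ ×ˢ (Set.Ici 0 ×ˢ Set.univ)
    else if j ∈ C then Set.Iio τ ×ˢ Set.univ else Set.univ

lemma mem_leadEvent {C : Finset (Fin m)} {τ : ℝ} {a : Fin m} {ω : RoundTape m} :
    ω ∈ leadEvent C τ a ↔
      (τ ≤ (ω a).1 ∧ 0 ≤ (ω a).2.1) ∧ ∀ j ∈ C, j ≠ a → (ω j).1 < τ := by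
  simp only [leadEvent, Set.mem_univ_pi]
  constructor
  · intro h
    refine ⟨by simpa [Set.mem_prod] using h a, fun j hj hja => ?_⟩
    have := h j
    rw [if_neg hja, if_pos hj] at this
    simpa using this.1
  · rintro ⟨⟨h1, h2⟩, h3⟩ j
    split_ifs with hja hj
    · subst hja; simp [Set.mem_prod, h1, h2]
    · simp [Set.mem_prod, h3 j hj hja]
    · trivial

/-- The event is a box: priority of `a` above `τ` (`1 - τ`), noise nonnegative (at least `1/2`), and
`|C| - 1` other priorities below `τ`. -/
lemma le_measureReal_leadEvent (hβ : 0 < β) (C : Finset (Fin m)) {τ : ℝ} (h0 : 0 ≤ τ) (h1 : τ ≤ 1)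
    {a : Fin m} (ha : a ∈ C) :
    (1 - τ) / 2 * τ ^ (C.card - 1) ≤ (roundLaw m β).real (leadEvent C τ a) := by
  classical
  have := isProbabilityMeasure_laplace hβ
  rw [roundLaw, leadEvent, measureReal_pi_univ_pi, ← Finset.mul_prod_erase _ _ (Finset.mem_univ a)]
  have e1 : ∏ j ∈ Finset.univ.erase a, (uniform01.prod ((laplace β).prod (laplace β))).real
      (if j = a then Set.Ici τ ×ˢ (Set.Ici 0 ×ˢ Set.univ)
        else if j ∈ C then Set.Iio τ ×ˢ Set.univ else Set.univ) = τ ^ (C.card - 1) := by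
    rw [← Finset.card_erase_of_mem ha, ← Finset.prod_const]
    rw [← Finset.prod_subset (Finset.erase_subset_erase a (Finset.subset_univ C))]
    · refine Finset.prod_congr rfl fun j hj => ?_
      rw [Finset.mem_erase] at hj
      rw [if_neg hj.1, if_pos hj.2, measureReal_prod_prod, uniform01_Iio h0 h1]
      simp
    · intro j hj hj'
      rw [Finset.mem_erase] at hj hj'
      rw [if_neg hj.1, if_neg fun h => hj' ⟨hj.1, h⟩]
      simp
  rw [e1, if_pos rfl, measureReal_prod_prod, measureReal_prod_prod, uniform01_Ici h0 h1]
  refine mul_le_mul_of_nonneg_right ?_ (by positivity)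
  have := half_le_laplace_Ici hβ
  simp only [probReal_univ, mul_one]
  nlinarith

/-- If `a'` is in `C`, the two requirements contradict each other; otherwise the box does not
constrain coordinate `a'`, and independence gives equality. -/
lemma measureReal_leadEvent_inter_le (hβ : 0 < β) (C : Finset (Fin m)) {τ : ℝ} (h0 : 0 ≤ τ)
    (h1 : τ ≤ 1) {a a' : Fin m} (ha : a' ≠ a) :
    (roundLaw m β).real (leadEvent C τ a ∩ {ω | τ ≤ (ω a').1}) ≤
      (1 - τ) * (roundLaw m β).real (leadEvent C τ a) := by
  classical
  have := isProbabilityMeasure_laplace hβ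
  have := isProbabilityMeasure_roundLaw m hβ
  by_cases haC : a' ∈ C
  · have : leadEvent C τ a ∩ {ω | τ ≤ (ω a').1} = ∅ := by
      ext ω
      simp only [Set.mem_inter_iff, mem_leadEvent, Set.mem_ofPred_eq, Set.mem_empty_iff_false,
        iff_false]
      rintro ⟨⟨_, h⟩, h'⟩
      exact absurd (h a' haC ha) (not_lt.2 h')
    rw [this, measureReal_empty]
    exact mul_nonneg (by linarith) measureReal_nonneg
  · set Q : Fin m → Set (ℝ × ℝ × ℝ) := fun j => if j = a then Set.Ici τ ×ˢ (Set.Ici 0 ×ˢ Set.univ)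
      else if j ∈ C then Set.Iio τ ×ˢ Set.univ else Set.univ with hQ
    have hQa : Q a' = Set.univ := by simp [hQ, ha, haC]
    have h2 : leadEvent C τ a ∩ {ω | τ ≤ (ω a').1} =
        Set.univ.pi (Function.update Q a' (Set.Ici τ ×ˢ Set.univ)) := by
      ext ω
      change (ω ∈ Set.univ.pi Q ∧ τ ≤ (ω a').1) ↔ _
      simp only [Set.mem_univ_pi]
      constructor
      · rintro ⟨h, h'⟩ j
        by_cases hj : j = a'
        · subst hj; simpa using h'
        · simpa [hj] using h j
      · intro h
        refine ⟨fun j => ?_, by simpa using h a'⟩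
        by_cases hj : j = a'
        · subst hj; rw [hQa]; trivial
        · simpa [hj] using h j
    have h3 : leadEvent C τ a = Set.univ.pi Q := rfl
    rw [h2, h3, roundLaw, measureReal_pi_univ_pi, measureReal_pi_univ_pi,
      ← Finset.mul_prod_erase _ _ (Finset.mem_univ a'),
      ← Finset.mul_prod_erase Finset.univ (fun j => (uniform01.prod _).real (Q j))
        (Finset.mem_univ a'), hQa, Function.update_self, measureReal_prod_prod,
      uniform01_Ici h0 h1, probReal_univ, probReal_univ, mul_one, one_mul]
    refine le_of_eq ?_
    congr 1
    refine Finset.prod_congr rfl fun j hj => ?_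
    rw [Function.update_of_ne (Finset.ne_of_mem_erase hj)]

variable {η θ : ℝ} {deg : Fin m → ℝ} {A : Finset (Fin m)} {B : Finset (Fin N)}

/-- The event that `a` is selected and has the strictly largest priority among the sets
containing `b`. -/
def winEvent (S : Fin m → Finset (Fin N)) (η : ℝ) (deg : Fin m → ℝ) (A : Finset (Fin m))
    (B : Finset (Fin N)) (a : Fin m) (b : Fin N) : Set (RoundTape m) :=
  {ω | (1 - 4 * η) * deg a ≤ ((picks S A B (fun a => (ω a).1) a).card : ℝ) + (ω a).2.1 ∧
    ∀ a' ∈ covering S A b, a' ≠ a → (ω a').1 < (ω a).1}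

/-- When `a` leads around `b`, it loses at most `η D` elements of higher degree than `b` (by
`hgood`) and, with conditional probability at least `1/2`, fewer than `η D` others. It is then
picked by at least `(1 - 2η) D` elements, which passes the selection test because `(1-2η)(1-η) ≥
1-4η`. -/
lemma le_measureReal_winEvent (hβ : 0 < β) (hη : 0 < η) (hη' : η < 1 / 4) {a : Fin m}
    (ha : a ∈ A) {b : Fin N} (hb : b ∈ S a ∩ B)
    (hok : (1 - η) * deg a ≤ ((S a ∩ B).card : ℝ))
    (hgood : (((S a ∩ B).filter fun b' =>
      (covering S A b).card < (covering S A b').card).card : ℝ) ≤ η * (S a ∩ B).card) :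
    η / 2 * (1 - η / 2) / 4 / (covering S A b).card ≤
      (roundLaw m β).real (winEvent S η deg A B a b) := by
  classical
  have := isProbabilityMeasure_roundLaw m hβ
  set d := (covering S A b).card with hd
  set D := (S a ∩ B).card with hD
  have hac : a ∈ covering S A b := by
    rw [covering, Finset.mem_filter]; exact ⟨ha, (Finset.mem_inter.1 hb).1⟩
  have hd1 : 1 ≤ d := Finset.card_pos.2 ⟨a, hac⟩
  have hd1' : (1 : ℝ) ≤ d := by exact_mod_cast hd1
  have hD1 : (1 : ℝ) ≤ D := by exact_mod_cast (Finset.card_pos.2 ⟨b, hb⟩ : 0 < D)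
  -- With threshold `1 - s/d`, a competitor exceeds it with probability `s/d`, so an element in at
  -- most `d` sets meets one with probability at most `s`. The choice `s = η/2` makes Markov's
  -- inequality at level `η D` give `1/2`.
  set s := η / 2 with hs
  have hsd : s / d ≤ 1 := by
    rw [div_le_one (by linarith)]; linarith
  have hsd0 : 0 ≤ s / d := by positivity
  set τ := 1 - s / d with hτ
  have hτ0 : 0 ≤ τ := by linarith
  have hτ1 : τ ≤ 1 := by linarith
  set F := leadEvent (covering S A b) τ a with hF
  have hFlow : s * (1 - s) / 2 / d ≤ (roundLaw m β).real F := by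
    refine le_trans ?_ (le_measureReal_leadEvent hβ _ hτ0 hτ1 hac)
    -- Bernoulli's inequality: the other sets around `b` all stay below `τ` with probability at
    -- least `1 - s`.
    have hber := one_add_mul_le_pow (a := -(s / d)) (by linarith) (d - 1)
    have : (1 + -(s / d)) = τ := by ring
    rw [this, Nat.cast_sub hd1] at hber
    have h5 : 1 - s ≤ τ ^ (d - 1) := by
      refine le_trans ?_ hber
      have : (d : ℝ) * (s / d) = s := by field_simp
      push_cast
      nlinarith
    rw [show 1 - τ = s / d by rw [hτ]; ring]
    calc s * (1 - s) / 2 / d = s / d / 2 * (1 - s) := by ring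
      _ ≤ _ := mul_le_mul_of_nonneg_left h5 (by positivity)
  set I := (S a ∩ B).filter fun b' => (covering S A b').card ≤ d with hI
  -- Some competitor at `b'` reaches `τ`. This contains the event that `b'` fails to pick `a`, since
  -- `a` itself is above `τ`.
  set lost : Fin N → Set (RoundTape m) := fun b' =>
    ⋃ a' ∈ (covering S A b').erase a, {ω | τ ≤ (ω a').1} with hlost
  have hmeas : ∀ a' : Fin m, MeasurableSet {ω : RoundTape m | τ ≤ (ω a').1} := fun a' =>
    measurableSet_le measurable_const (measurable_pi_apply a').fst
  have hlostm : ∀ b', MeasurableSet (lost b') := fun b' =>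
    Finset.measurableSet_biUnion _ fun a' _ => hmeas a'
  have hlostle : ∀ b' ∈ I, (roundLaw m β).real (F ∩ lost b') ≤ s * (roundLaw m β).real F := by
    intro b' hb'
    have hb'd := (Finset.mem_filter.1 hb').2
    rw [hlost, Set.inter_iUnion₂]
    refine (measureReal_biUnion_finset_le _ _).trans ?_
    refine (Finset.sum_le_sum fun a' ha' =>
      measureReal_leadEvent_inter_le hβ _ hτ0 hτ1 (Finset.ne_of_mem_erase ha')).trans ?_
    rw [Finset.sum_const, nsmul_eq_mul, ← mul_assoc]
    refine mul_le_mul_of_nonneg_right ?_ measureReal_nonneg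
    have h6 : (((covering S A b').erase a).card : ℝ) ≤ d := by
      exact_mod_cast (Finset.card_le_card (Finset.erase_subset _ _)).trans hb'd
    rw [show 1 - τ = s / d by rw [hτ]; ring]
    calc _ ≤ d * (s / d) := mul_le_mul_of_nonneg_right h6 hsd0
      _ = s := by field_simp
  have hmarkov := mul_measureReal_card_le (roundLaw m β) I lost (fun b' _ => hlostm b') F
    (t := η * D) (by positivity)
  set bad : Set (RoundTape m) := {ω | η * D ≤ ((I.filter fun i => ω ∈ lost i).card : ℝ)} with hbad
  have hbadm : MeasurableSet bad := by
    refine measurableSet_le measurable_const ?_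
    refine (Measurable.of_discrete (f := fun T : Finset (Fin N) => (T.card : ℝ))).comp ?_
    exact measurable_finset_filter I fun i _ => measurableSet_setOfPred.1 (hlostm i)
  have hhalf : (roundLaw m β).real (F ∩ bad) ≤ (roundLaw m β).real F / 2 := by
    have h7 : ∑ i ∈ I, (roundLaw m β).real (F ∩ lost i) ≤ D * (s * (roundLaw m β).real F) := by
      refine (Finset.sum_le_sum hlostle).trans ?_
      rw [Finset.sum_const, nsmul_eq_mul]
      refine mul_le_mul_of_nonneg_right ?_ (by positivity)
      exact_mod_cast Finset.card_le_card (Finset.filter_subset _ _)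
    have h8 := hmarkov.trans h7
    have h9 : 0 < η * D := by positivity
    rw [show D * (s * (roundLaw m β).real F) = η * D * ((roundLaw m β).real F / 2) by
      rw [hs]; ring] at h8
    exact le_of_mul_le_mul_left h8 h9
  have hdiff := measureReal_inter_add_sdiff (μ := roundLaw m β) (s := F) hbadm
  have hsub : F \ bad ⊆ winEvent S η deg A B a b := by
    rintro ω ⟨hωF, hωb⟩
    obtain ⟨⟨hx, hu⟩, hlt⟩ := mem_leadEvent.1 hωF
    have hωb' : ((I.filter fun i => ω ∈ lost i).card : ℝ) < η * D := not_le.1 hωb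
    refine ⟨?_, fun a' ha' hne => (hlt a' ha' hne).trans_le hx⟩
    have hsubset : S a ∩ B ⊆ picks S A B (fun a => (ω a).1) a ∪
        (((S a ∩ B).filter fun b' => d < (covering S A b').card) ∪
          I.filter fun i => ω ∈ lost i) := by
      intro b' hb'
      simp only [Finset.mem_union, Finset.mem_filter, hI]
      by_cases h1 : d < (covering S A b').card
      · exact Or.inr (Or.inl ⟨hb', h1⟩)
      by_cases h2 : ω ∈ lost b'
      · exact Or.inr (Or.inr ⟨⟨hb', not_lt.1 h1⟩, h2⟩)
      left
      rw [Finset.mem_inter] at hb'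
      simp only [picks, Finset.mem_filter]
      refine ⟨hb'.2, hb'.1, fun a' ha' hba' => ?_⟩
      by_cases haa : a' = a
      · rw [haa]
      · by_contra hc
        refine h2 ?_
        simp only [hlost, Set.mem_iUnion]
        refine ⟨a', Finset.mem_erase.2 ⟨haa, Finset.mem_filter.2 ⟨ha', hba'⟩⟩, ?_⟩
        exact hx.trans (not_le.1 hc).le
    have hcard : (D : ℝ) ≤ (picks S A B (fun a => (ω a).1) a).card +
        (((S a ∩ B).filter fun b' => d < (covering S A b').card).card +
          (I.filter fun i => ω ∈ lost i).card) := by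
      exact_mod_cast (Finset.card_le_card hsubset).trans
        ((Finset.card_union_le _ _).trans (Nat.add_le_add_left (Finset.card_union_le _ _) _))
    have hpk : (1 - 2 * η) * D ≤ ((picks S A B (fun a => (ω a).1) a).card : ℝ) := by linarith
    -- The degree estimate is noisy and may be negative; the selection test is then passed
    -- trivially.
    rcases le_total 0 (deg a) with h0 | h0
    · nlinarith
    · have : (0 : ℝ) ≤ (picks S A B (fun a => (ω a).1) a).card := Nat.cast_nonneg _
      nlinarith
  have := measureReal_mono (μ := roundLaw m β) hsub
  calc s * (1 - s) / 4 / d = s * (1 - s) / 2 / d / 2 := by ring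
    _ ≤ (roundLaw m β).real F / 2 := by linarith
    _ ≤ _ := by linarith

end

/-! ### Charging lost edges: expected decay in one round -/

section

variable {m N : ℕ} (S : Fin m → Finset (Fin N)) {β η θ : ℝ} {deg : Fin m → ℝ}

lemma sum_edges_eq_sum_elements (A : Finset (Fin m)) (B : Finset (Fin N))
    (f : Fin m × Fin N → ℝ) :
    ∑ e ∈ edges S A B, f e = ∑ b ∈ B, ∑ a ∈ covering S A b, f (a, b) := by
  simp only [edges, covering, Finset.sum_filter, Finset.sum_product_right]

lemma sum_edges_eq_sum_sets (A : Finset (Fin m)) (B : Finset (Fin N))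
    (f : Fin m × Fin N → ℝ) :
    ∑ e ∈ edges S A B, f e = ∑ a ∈ A, ∑ b ∈ S a ∩ B, f (a, b) := by
  simp only [edges, Finset.sum_filter, Finset.sum_product]
  refine Finset.sum_congr rfl fun a _ => ?_
  rw [← Finset.sum_filter, Finset.filter_mem_eq_inter, Finset.inter_comm]

/-- The guaranteed expected fraction of edges removed by a round. -/
noncomputable def decayRate (η : ℝ) : ℝ := η / 2 * (η / 2 * (1 - η / 2) / 4)

lemma decayRate_pos {η : ℝ} (hη : 0 < η) (hη' : η < 1 / 4) : 0 < decayRate η := by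
  have : 0 < 1 - η / 2 := by linarith
  unfold decayRate; positivity

lemma decayRate_lt_one {η : ℝ} (hη : 0 < η) (hη' : η < 1 / 4) : decayRate η < 1 := by
  have h1 : η / 2 * (1 - η / 2) ≤ 1 := by nlinarith
  have h2 : η / 2 * (η / 2 * (1 - η / 2) / 4) ≤ η / 2 * (1 / 4) :=
    mul_le_mul_of_nonneg_left (by linarith) (by linarith)
  unfold decayRate; linarith

/-- The event that the edge `e` does not survive the round. -/
def lostEvent (S : Fin m → Finset (Fin N)) (η θ : ℝ) (deg : Fin m → ℝ) (s : ManisState m N)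
    (e : Fin m × Fin N) : Set (RoundTape m) :=
  {ω | ¬ (e.1 ∈ (manisStep S η θ deg s ω).A ∧ e.2 ∈ (manisStep S η θ deg s ω).B)}

lemma measurableSet_lostEvent (s : ManisState m N) (e : Fin m × Fin N) :
    MeasurableSet (lostEvent S η θ deg s e) :=
  (measurable_manisStep_of_state S η θ (deg := fun _ : RoundTape m => deg) s measurable_const
    measurable_id) (MeasurableSet.of_discrete (s := {t : ManisState m N | ¬ (e.1 ∈ t.A ∧ e.2 ∈ t.B)}))

/-- A set already below the survival threshold can only shrink, so nonpositive survival noise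
removes it, unless it was selected, which removes it too. -/
lemma half_le_measureReal_lostEvent (hβ : 0 < β) {s : ManisState m N} {e : Fin m × Fin N}
    (hbad : ((S e.1 ∩ s.B).card : ℝ) < (1 - η) * deg e.1 + θ) :
    1 / 2 ≤ (roundLaw m β).real (lostEvent S η θ deg s e) := by
  have := isProbabilityMeasure_laplace hβ
  have := isProbabilityMeasure_roundLaw m hβ
  have hm : MeasurableSet (Set.univ ×ˢ (Set.univ ×ˢ Set.Iic 0) : Set (ℝ × ℝ × ℝ)) :=
    MeasurableSet.univ.prod (MeasurableSet.univ.prod measurableSet_Iic)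
  have h1 : (roundLaw m β).real {ω | ω e.1 ∈ (Set.univ ×ˢ (Set.univ ×ˢ Set.Iic 0) :
      Set (ℝ × ℝ × ℝ))} = (laplace β).real (Set.Iic 0) := by
    rw [measureReal_def, roundLaw, measure_pi_eval_preimage _ _ hm, ← measureReal_def,
      measureReal_prod_prod, measureReal_prod_prod]
    simp
  refine (half_le_laplace_Iic hβ).trans (h1 ▸ measureReal_mono ?_)
  intro ω hω hcon
  have hω' : (ω e.1).2.2 ≤ 0 := hω.2.2
  have h2 := (Finset.mem_filter.1 hcon.1).2
  have h3 : (((S e.1 ∩ s.B) ∩ (manisStep S η θ deg s ω).B).card : ℝ) ≤ (S e.1 ∩ s.B).card := by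
    exact_mod_cast Finset.card_le_card Finset.inter_subset_left
  have h4 : (1 - η) * deg e.1 + θ ≤
      (((S e.1 ∩ s.B) ∩ (manisStep S η θ deg s ω).B).card : ℝ) + (ω e.1).2.2 := h2
  linarith

-- The winning events of different sets at `b` are disjoint, because the strict leader around `b` is
-- unique. So their probabilities, each of order `1/d` with `d` the degree of `b`, add up to a lower
-- bound for the probability that `b` is covered.
open Classical in
lemma mul_card_le_measureReal_covered (hβ : 0 < β) (hη : 0 < η) (hη' : η < 1 / 4) (hθ : 0 ≤ θ)
    (s : ManisState m N) {b : Fin N} (hb : b ∈ s.B) (G : Finset (Fin m))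
    (hGC : G ⊆ covering S s.A b)
    (hG : ∀ a ∈ G, (1 - η) * deg a + θ ≤ ((S a ∩ s.B).card : ℝ) ∧
      (((S a ∩ s.B).filter fun b' =>
        (covering S s.A b).card < (covering S s.A b').card).card : ℝ) ≤ η * (S a ∩ s.B).card) :
    η / 2 * (1 - η / 2) / 4 * G.card ≤ (covering S s.A b).card *
      (roundLaw m β).real {ω | b ∉ (manisStep S η θ deg s ω).B} := by
  have := isProbabilityMeasure_roundLaw m hβ
  rcases (covering S s.A b).eq_empty_or_nonempty with h0 | h0
  · have : G = ∅ := Finset.subset_empty.1 (h0 ▸ hGC)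
    simp [this, h0]
  have hd : (0 : ℝ) < (covering S s.A b).card := by exact_mod_cast Finset.card_pos.2 h0
  have hmem : ∀ a ∈ G, a ∈ s.A ∧ b ∈ S a := fun a ha => Finset.mem_filter.1 (hGC ha)
  have hwm : ∀ a ∈ G, MeasurableSet (winEvent S η deg s.A s.B a b) := by
    intro a _
    have hp : Measurable fun ω : RoundTape m => picks S s.A s.B (fun a => (ω a).1) a :=
      measurable_picks S s.A s.B (fun a => (measurable_pi_apply a).fst) a
    refine MeasurableSet.inter (measurableSet_le measurable_const (Measurable.add
      ((Measurable.of_discrete (f := fun T : Finset (Fin N) => (T.card : ℝ))).comp hp)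
      (measurable_pi_apply a).snd.fst)) ?_
    change MeasurableSet {ω : RoundTape m | ∀ a' ∈ covering S s.A b, a' ≠ a → (ω a').1 < (ω a).1}
    have : {ω : RoundTape m | ∀ a' ∈ covering S s.A b, a' ≠ a → (ω a').1 < (ω a).1} =
        ⋂ a' ∈ (covering S s.A b).erase a, {ω | (ω a').1 < (ω a).1} := by
      ext ω
      simp only [Set.mem_iInter, Set.mem_ofPred_eq, Finset.mem_erase]
      exact ⟨fun h a' h' => h a' h'.2 h'.1, fun h a' h1 h2 => h a' ⟨h2, h1⟩⟩
    rw [this]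
    exact Finset.measurableSet_biInter _ fun a' _ =>
      measurableSet_lt (measurable_pi_apply a').fst (measurable_pi_apply a).fst
  have hdisj : Set.PairwiseDisjoint (G : Set (Fin m)) fun a => winEvent S η deg s.A s.B a b := by
    intro a ha a' ha' hne
    refine Set.disjoint_left.2 fun ω h1 h2 => ?_
    exact lt_asymm (h1.2 a' (hGC ha') hne.symm) (h2.2 a (hGC ha) hne)
  have hsub : (⋃ a ∈ G, winEvent S η deg s.A s.B a b) ⊆
      {ω | b ∉ (manisStep S η θ deg s ω).B} := by
    intro ω hω
    simp only [Set.mem_iUnion] at hω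
    obtain ⟨a, ha, hw⟩ := hω
    simp only [Set.mem_ofPred_eq, manisStep, Finset.mem_sdiff, Finset.mem_biUnion, not_and, not_not]
    exact fun _ => ⟨a, Finset.mem_filter.2 ⟨(hmem a ha).1, hw.1⟩, (hmem a ha).2⟩
  have h1 := measureReal_mono (μ := roundLaw m β) hsub
  rw [measureReal_biUnion_finset hdisj hwm] at h1
  have h2 : ∑ _a ∈ G, η / 2 * (1 - η / 2) / 4 / (covering S s.A b).card ≤
      ∑ a ∈ G, (roundLaw m β).real (winEvent S η deg s.A s.B a b) := by
    refine Finset.sum_le_sum fun a ha => ?_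
    refine le_measureReal_winEvent S hβ hη hη' (hmem a ha).1
      (Finset.mem_inter.2 ⟨(hmem a ha).2, hb⟩) ?_ ?_
    · linarith [(hG a ha).1]
    · convert (hG a ha).2
  rw [Finset.sum_const, nsmul_eq_mul] at h2
  calc _ = (covering S s.A b).card * (G.card *
        (η / 2 * (1 - η / 2) / 4 / (covering S s.A b).card)) := by field_simp
    _ ≤ _ := mul_le_mul_of_nonneg_left (h2.trans h1) hd.le

/-- Edges of sets below the survival threshold are lost with probability at least `1/2`. In the
other sets a fraction `η` of the elements is good, and summing over elements charges each good edge
with at least `p`. Each of the two counts is bounded by the same expected loss `L`; adding them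
costs the final factor `2`. -/
lemma decayRate_mul_card_le (hβ : 0 < β) (hη : 0 < η) (hη' : η < 1 / 4) (hθ : 0 ≤ θ)
    (s : ManisState m N) :
    decayRate η * (edges S s.A s.B).card ≤
      ∑ e ∈ edges S s.A s.B, (roundLaw m β).real (lostEvent S η θ deg s e) := by
  classical
  have := isProbabilityMeasure_roundLaw m hβ
  set p := η / 2 * (1 - η / 2) / 4 with hp
  have hp0 : 0 < p := by
    have : 0 < 1 - η / 2 := by linarith
    positivity
  have hpη : p * η ≤ 1 / 2 := by
    have : p ≤ 1 / 2 := by rw [hp]; nlinarith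
    nlinarith
  set ok : Fin m → Prop := fun a => (1 - η) * deg a + θ ≤ ((S a ∩ s.B).card : ℝ) with hok
  set good : Fin m → Fin N → Prop := fun a b => ok a ∧
    (((S a ∩ s.B).filter fun b' =>
      (covering S s.A b).card < (covering S s.A b').card).card : ℝ) ≤ η * (S a ∩ s.B).card
    with hgood
  set L := ∑ e ∈ edges S s.A s.B, (roundLaw m β).real (lostEvent S η θ deg s e) with hL
  have h1 : ∑ e ∈ edges S s.A s.B, (if ok e.1 then (0 : ℝ) else 1 / 2) ≤ L := by
    refine Finset.sum_le_sum fun e _ => ?_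
    split_ifs with h
    · exact measureReal_nonneg
    · exact half_le_measureReal_lostEvent S hβ (not_le.1 h)
  have h2 : ∑ e ∈ edges S s.A s.B, p * (if good e.1 e.2 then (1 : ℝ) else 0) ≤ L := by
    rw [hL, sum_edges_eq_sum_elements, sum_edges_eq_sum_elements]
    refine Finset.sum_le_sum fun b hb => ?_
    rw [← Finset.mul_sum]
    have := mul_card_le_measureReal_covered (deg := deg) S hβ hη hη' hθ s hb
      ((covering S s.A b).filter fun a => good a b) (Finset.filter_subset _ _)
      (fun a ha => (Finset.mem_filter.1 ha).2)
    rw [Finset.sum_boole]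
    refine this.trans ?_
    -- Covering `b` destroys every edge at `b`, so the degree times the probability of covering is
    -- at most the sum of the loss probabilities at `b`.
    rw [← nsmul_eq_mul, ← Finset.sum_const]
    refine Finset.sum_le_sum fun a _ => measureReal_mono ?_
    exact fun ω hω h => hω h.2
  rw [sum_edges_eq_sum_sets] at h1 h2
  have h3 : ∀ a ∈ s.A, p * η * (S a ∩ s.B).card ≤
      ∑ b ∈ S a ∩ s.B, (if ok a then (0 : ℝ) else 1 / 2) +
        ∑ b ∈ S a ∩ s.B, p * (if good a b then (1 : ℝ) else 0) := by
    intro a _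
    by_cases ha : ok a
    · simp only [ha, if_true, Finset.sum_const_zero, zero_add]
      rw [← Finset.mul_sum, Finset.sum_boole, mul_assoc]
      refine mul_le_mul_of_nonneg_left ?_ hp0.le
      have := mul_card_le_card_filter_exceeded (S a ∩ s.B) (fun b => (covering S s.A b).card)
        (η := η) (by linarith)
      refine this.trans (le_of_eq ?_)
      congr 2
      ext b
      simp [hgood, ha]
    · simp only [ha, if_false, Finset.sum_const, nsmul_eq_mul]
      have h4 : 0 ≤ ∑ b ∈ S a ∩ s.B, p * (if good a b then (1 : ℝ) else 0) :=
        Finset.sum_nonneg fun b _ => by split_ifs <;> simp [hp0.le]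
      nlinarith [(Nat.cast_nonneg (S a ∩ s.B).card : (0 : ℝ) ≤ _)]
  have h5 := Finset.sum_le_sum h3
  rw [Finset.sum_add_distrib, ← Finset.mul_sum] at h5
  have h6 : ((edges S s.A s.B).card : ℝ) = ∑ a ∈ s.A, ((S a ∩ s.B).card : ℝ) := by
    have := sum_edges_eq_sum_sets S s.A s.B fun _ => 1
    simpa using this
  have h7 : decayRate η = p * η / 2 := by rw [decayRate, hp]; ring
  rw [h6, h7]
  linarith

lemma lintegral_card_edges_manisStep_le (hβ : 0 < β) (hη : 0 < η) (hη' : η < 1 / 4) (hθ : 0 ≤ θ)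
    (s : ManisState m N) :
    ∫⁻ ω, ((edges S (manisStep S η θ deg s ω).A (manisStep S η θ deg s ω).B).card : ENNReal)
      ∂roundLaw m β ≤ ENNReal.ofReal (1 - decayRate η) * (edges S s.A s.B).card := by
  classical
  have := isProbabilityMeasure_roundLaw m hβ
  have hc : ∀ ω, ((edges S (manisStep S η θ deg s ω).A (manisStep S η θ deg s ω).B).card : ENNReal)
      = ∑ e ∈ edges S s.A s.B,
        (lostEvent S η θ deg s e)ᶜ.indicator (fun _ => (1 : ENNReal)) ω := by
    intro ω
    have : edges S (manisStep S η θ deg s ω).A (manisStep S η θ deg s ω).B =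
        (edges S s.A s.B).filter fun e => ω ∈ (lostEvent S η θ deg s e)ᶜ := by
      ext e
      have hA : e.1 ∈ (manisStep S η θ deg s ω).A → e.1 ∈ s.A := fun h =>
        (Finset.mem_sdiff.1 (Finset.mem_filter.1 h).1).1
      have hB : e.2 ∈ (manisStep S η θ deg s ω).B → e.2 ∈ s.B := fun h =>
        (Finset.mem_sdiff.1 h).1
      simp only [edges, Finset.mem_filter, Finset.mem_product, lostEvent, Set.mem_compl_iff,
        Set.mem_ofPred_eq, not_not]
      tauto
    rw [this, Finset.card_filter, Nat.cast_sum]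
    simp [Set.indicator_apply]
  simp only [hc]
  have hm : ∀ e, MeasurableSet (lostEvent S η θ deg s e)ᶜ := fun e =>
    (measurableSet_lostEvent S s e).compl
  rw [lintegral_finsetSum _ fun e _ => measurable_const.indicator (hm e)]
  have h1 : ∀ e, ∫⁻ ω, (lostEvent S η θ deg s e)ᶜ.indicator (fun _ => (1 : ENNReal)) ω
      ∂roundLaw m β = ENNReal.ofReal (1 - (roundLaw m β).real (lostEvent S η θ deg s e)) := by
    intro e
    rw [← probReal_compl_eq_one_sub (measurableSet_lostEvent S s e), ofReal_measureReal]
    exact lintegral_indicator_one (hm e)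
  simp only [h1]
  rw [← ENNReal.ofReal_sum_of_nonneg fun e _ => sub_nonneg.2 measureReal_le_one]
  have h2 : 0 ≤ 1 - decayRate η := by linarith [decayRate_lt_one hη hη']
  rw [← ENNReal.ofReal_natCast, ← ENNReal.ofReal_mul h2]
  refine ENNReal.ofReal_le_ofReal ?_
  rw [Finset.sum_sub_distrib]
  have := decayRate_mul_card_le (deg := deg) S hβ hη hη' hθ s
  simp only [Finset.sum_const, nsmul_eq_mul, mul_one]
  linarith

end

/-! ### Running the rounds -/

section

variable {m N R : ℕ} (S : Fin m → Finset (Fin N)) (η θ : ℝ)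

/-- The state after the first `r` rounds. -/
noncomputable def manisRun (deg : Fin m → ℝ) (s : ManisState m N) (ω : Fin R → RoundTape m)
    (r : ℕ) : ManisState m N :=
  ((List.ofFn ω).take r).foldl (manisStep S η θ deg) s

lemma manisRun_zero (deg : Fin m → ℝ) (s : ManisState m N) (ω : Fin R → RoundTape m) :
    manisRun S η θ deg s ω 0 = s := by simp [manisRun]

lemma manisRun_succ (deg : Fin m → ℝ) (s : ManisState m N) (ω : Fin R → RoundTape m) {r : ℕ}
    (hr : r < R) : manisRun S η θ deg s ω (r + 1) =
      manisStep S η θ deg (manisRun S η θ deg s ω r) (ω ⟨r, hr⟩) := by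
  simp [manisRun, List.take_add_one, List.foldl_append, hr]

lemma manisRun_all (deg : Fin m → ℝ) (s : ManisState m N) (ω : Fin R → RoundTape m) :
    manisRun S η θ deg s ω R = (List.ofFn ω).foldl (manisStep S η θ deg) s := by
  simp [manisRun, List.take_of_length_le]

/-- The state before round `i` ignores the draws of round `i`; this is the independence that lets
the decay be iterated. -/
lemma manisRun_update (deg : Fin m → ℝ) (s : ManisState m N) (ω : Fin R → RoundTape m) (i : Fin R)
    (y : RoundTape m) {r : ℕ} (hr : r ≤ i) :
    manisRun S η θ deg s (Function.update ω i y) r = manisRun S η θ deg s ω r := by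
  induction r with
  | zero => simp only [manisRun_zero]
  | succ r ih =>
    have hrR : r < R := lt_of_lt_of_le (Nat.lt_of_succ_le hr) i.2.le
    rw [manisRun_succ _ _ _ _ _ _ hrR, manisRun_succ _ _ _ _ _ _ hrR, ih (by omega),
      Function.update_of_ne]
    intro h
    rw [← h] at hr
    simp at hr

lemma measurable_manisRun {Z : Type*} [MeasurableSpace Z] {deg : Z → Fin m → ℝ}
    {s : Z → ManisState m N} {ω : Z → Fin R → RoundTape m} (hd : Measurable deg)
    (hs : Measurable s) (hω : Measurable ω) {r : ℕ} (hr : r ≤ R) :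
    Measurable fun z => manisRun S η θ (deg z) (s z) (ω z) r := by
  induction r with
  | zero => simpa only [manisRun_zero] using hs
  | succ r ih =>
    simp only [manisRun_succ _ _ _ _ _ _ (Nat.lt_of_succ_le hr)]
    exact measurable_manisStep S η θ hd (ih (by omega)) (measurable_pi_iff.1 hω _)

variable {β : ℝ} {η θ}

lemma lintegral_card_edges_manisRun_le (hβ : 0 < β) (hη : 0 < η) (hη' : η < 1 / 4) (hθ : 0 ≤ θ)
    (deg : Fin m → ℝ) (s : ManisState m N) {r : ℕ} (hr : r ≤ R) :
    ∫⁻ ω, ((edges S (manisRun S η θ deg s ω r).A (manisRun S η θ deg s ω r).B).card : ENNReal)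
      ∂(Measure.pi fun _ : Fin R => roundLaw m β) ≤
      ENNReal.ofReal (1 - decayRate η) ^ r * (edges S s.A s.B).card := by
  have := isProbabilityMeasure_roundLaw m hβ
  induction r with
  | zero => simp [manisRun_zero]
  | succ r ih =>
    have hrR : r < R := Nat.lt_of_succ_le hr
    simp only [manisRun_succ _ _ _ _ _ _ hrR]
    have hcard : Measurable fun t : ManisState m N => ((edges S t.A t.B).card : ENNReal) :=
      Measurable.of_discrete
    have hm : Measurable fun ω : Fin R → RoundTape m => manisRun S η θ deg s ω r :=
      measurable_manisRun S η θ measurable_const measurable_const measurable_id hrR.le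
    have hg : Measurable fun p : ManisState m N × RoundTape m =>
        ((edges S (manisStep S η θ deg p.1 p.2).A (manisStep S η θ deg p.1 p.2).B).card : ENNReal) :=
      hcard.comp (measurable_manisStep S η θ measurable_const measurable_fst measurable_snd)
    refine (lintegral_pi_of_update (fun _ : Fin R => roundLaw m β) ⟨r, hrR⟩ hm
      (fun ω y => manisRun_update S η θ deg s ω ⟨r, hrR⟩ y le_rfl) hg).le.trans ?_
    refine (lintegral_mono fun ω => lintegral_card_edges_manisStep_le (deg := deg) S hβ hη hη' hθ
      (manisRun S η θ deg s ω r)).trans ?_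
    have hcm : Measurable fun ω : Fin R → RoundTape m =>
      ((edges S (manisRun S η θ deg s ω r).A (manisRun S η θ deg s ω r).B).card : ENNReal) :=
      hcard.comp hm
    rw [lintegral_const_mul _ hcm, pow_succ', mul_assoc]
    exact mul_le_mul_right (ih hrR.le) _

/-- Markov's inequality at level `1` for an integer count, which starts at no more than `m N`. -/
lemma measure_edges_manisRun_nonempty_le (hβ : 0 < β) (hη : 0 < η) (hη' : η < 1 / 4) (hθ : 0 ≤ θ)
    (deg : Fin m → ℝ) (s : ManisState m N) :
    (Measure.pi fun _ : Fin R => roundLaw m β)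
      {ω | (edges S (manisRun S η θ deg s ω R).A (manisRun S η θ deg s ω R).B).Nonempty} ≤
      ENNReal.ofReal (1 - decayRate η) ^ R * (m * N : ℕ) := by
  have hcard : Measurable fun t : ManisState m N => ((edges S t.A t.B).card : ENNReal) :=
    Measurable.of_discrete
  have hm : Measurable fun ω : Fin R → RoundTape m => manisRun S η θ deg s ω R :=
    measurable_manisRun S η θ measurable_const measurable_const measurable_id le_rfl
  have h := mul_meas_ge_le_lintegral (μ := Measure.pi fun _ : Fin R => roundLaw m β)
    (hcard.comp hm) 1
  rw [one_mul] at h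
  refine (measure_mono ?_).trans (h.trans
    ((lintegral_card_edges_manisRun_le S hβ hη hη' hθ deg s le_rfl).trans ?_))
  · intro ω hω
    have : 1 ≤ (edges S (manisRun S η θ deg s ω R).A (manisRun S η θ deg s ω R).B).card :=
      Finset.card_pos.2 hω
    simpa using this
  · refine mul_le_mul_right ?_ _
    have h1 : (edges S s.A s.B).card ≤ m * N := by
      refine (Finset.card_filter_le _ _).trans ?_
      rw [Finset.card_product]
      exact Nat.mul_le_mul ((Finset.card_le_univ _).trans (by simp))
        ((Finset.card_le_univ _).trans (by simp))
    exact_mod_cast h1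

end

/-! ### Deterministic guarantees of a call -/

/-- `Q` holds for every entry of `l` together with the entries preceding it. -/
def PrefixAll {α : Type*} (Q : List α → α → Prop) (l : List α) : Prop :=
  ∀ P a T, l = P ++ a :: T → Q P a

lemma prefixAll_nil {α : Type*} (Q : List α → α → Prop) : PrefixAll Q [] := by
  intro P a T h
  simp at h

lemma PrefixAll.append {α : Type*} {Q : List α → α → Prop} {l₁ l₂ : List α} (h₁ : PrefixAll Q l₁)
    (h₂ : PrefixAll (fun P a => Q (l₁ ++ P) a) l₂) : PrefixAll Q (l₁ ++ l₂) := by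
  intro P a T h
  rcases List.append_eq_append_iff.1 h with ⟨as, rfl, h'⟩ | ⟨bs, rfl, h'⟩
  · exact h₂ as a T h'
  · cases bs with
    -- The split falls exactly between the lists: the entry is the first one of `l₂`.
    | nil => simpa using h₂ [] a T (by simpa using h'.symm)
    | cons b bs =>
      rw [List.cons_append, List.cons.injEq] at h'
      exact h₁ P a bs (by rw [h'.1])

lemma mem_sortByPriority {m : ℕ} {x : Fin m → ℝ} {J : Finset (Fin m)} {a : Fin m} :
    a ∈ sortByPriority x J ↔ a ∈ J := by
  simp [sortByPriority]

lemma nodup_sortByPriority {m : ℕ} (x : Fin m → ℝ) (J : Finset (Fin m)) :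
    (sortByPriority x J).Nodup := by
  unfold sortByPriority
  exact (List.perm_insertionSort _ _).nodup_iff.2 ((List.nodup_finRange m).filter _)

lemma pairwise_sortByPriority {m : ℕ} (x : Fin m → ℝ) (J : Finset (Fin m)) :
    (sortByPriority x J).Pairwise fun a a' => x a' ≤ x a := by
  classical
  unfold sortByPriority
  have : Std.Total fun a a' : Fin m => x a' ≤ x a := ⟨fun a a' => le_total _ _⟩
  have : IsTrans (Fin m) fun a a' : Fin m => x a' ≤ x a := ⟨fun a b c h1 h2 => h2.trans h1⟩
  exact List.pairwise_insertionSort _ _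

section

variable {m N R : ℕ} (S : Fin m → Finset (Fin N)) {η θ : ℝ} {deg : Fin m → ℝ}

/-- The bookkeeping invariant of a call on the sets `A₀` and the elements `B₀`. -/
structure ManisInv (A₀ : Finset (Fin m)) (B₀ : Finset (Fin N)) (s : ManisState m N) : Prop where
  nodup : s.out.Nodup
  out_sub : ∀ a ∈ s.out, a ∈ A₀
  A_sub : s.A ⊆ A₀
  disj : ∀ a ∈ s.out, a ∉ s.A
  B_eq : s.B = B₀ \ s.out.toFinset.biUnion S

variable {S} {A₀ : Finset (Fin m)} {B₀ : Finset (Fin N)} {s : ManisState m N} {ω : RoundTape m}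

lemma mem_out_manisStep {a : Fin m} : a ∈ (manisStep S η θ deg s ω).out ↔ a ∈ s.out ∨
    (a ∈ s.A ∧ (1 - 4 * η) * deg a ≤
      ((picks S s.A s.B (fun a => (ω a).1) a).card : ℝ) + (ω a).2.1) := by
  simp [manisStep, mem_sortByPriority]

lemma mem_A_manisStep {a : Fin m} (h : a ∈ (manisStep S η θ deg s ω).A) :
    a ∈ s.A ∧ ¬ ((1 - 4 * η) * deg a ≤
      ((picks S s.A s.B (fun a => (ω a).1) a).card : ℝ) + (ω a).2.1) := by
  have h1 := Finset.mem_sdiff.1 (Finset.mem_filter.1 h).1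
  exact ⟨h1.1, fun h2 => h1.2 (Finset.mem_filter.2 ⟨h1.1, h2⟩)⟩

lemma ManisInv.step (h : ManisInv S A₀ B₀ s) : ManisInv S A₀ B₀ (manisStep S η θ deg s ω) where
  nodup := by
    refine List.Nodup.append h.nodup (nodup_sortByPriority _ _) ?_
    intro a ha ha'
    exact h.disj a ha (Finset.mem_filter.1 (mem_sortByPriority.1 ha')).1
  out_sub := by
    intro a ha
    rcases mem_out_manisStep.1 ha with ha | ha
    · exact h.out_sub a ha
    · exact h.A_sub ha.1
  A_sub := fun a ha => h.A_sub (mem_A_manisStep ha).1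
  disj := by
    intro a ha ha'
    rcases mem_out_manisStep.1 ha with ha | ha
    · exact h.disj a ha (mem_A_manisStep ha').1
    · exact (mem_A_manisStep ha').2 ha.2
  B_eq := by
    have hB : (manisStep S η θ deg s ω).B = s.B \ (s.A.filter fun a => (1 - 4 * η) * deg a ≤
      ((picks S s.A s.B (fun a => (ω a).1) a).card : ℝ) + (ω a).2.1).biUnion S := by
      simp only [manisStep, ge_iff_le]
    have hb : ∀ b, b ∈ s.B ↔ b ∈ B₀ ∧ ¬ ∃ a ∈ s.out, b ∈ S a := by
      intro b; rw [h.B_eq]; simp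
    rw [hB]
    ext b
    simp only [hb, Finset.mem_sdiff, Finset.mem_biUnion, List.mem_toFinset, mem_out_manisStep,
      Finset.mem_filter]
    constructor
    · rintro ⟨⟨h1, h2⟩, h3⟩
      refine ⟨h1, ?_⟩
      rintro ⟨a, ha | ha, hb⟩
      · exact h2 ⟨a, ha, hb⟩
      · exact h3 ⟨a, ha, hb⟩
    · rintro ⟨h1, h2⟩
      exact ⟨⟨h1, fun ⟨a, ha, hb⟩ => h2 ⟨a, Or.inl ha, hb⟩⟩,
        fun ⟨a, ha, hb⟩ => h2 ⟨a, Or.inr ha, hb⟩⟩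

/-- The coverage guarantees of a call whose noise is at most `z`. -/
structure ManisCoverage (S : Fin m → Finset (Fin N)) (η z : ℝ) (A₀ : Finset (Fin m))
    (B₀ : Finset (Fin N)) (s : ManisState m N) : Prop where
  new : PrefixAll (fun P a => (1 - 4 * η) * (S a ∩ B₀).card - 2 * z ≤
    (((S a ∩ B₀) \ P.toFinset.biUnion S).card : ℝ)) s.out
  dropped : ∀ a ∈ A₀, a ∈ s.out ∨ a ∈ s.A ∨
    ((S a ∩ s.B).card : ℝ) ≤ (1 - η) * (S a ∩ B₀).card + 3 * z

/-- Elements picking `a` avoid the earlier output because they are still in `s.B`, and avoid the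
sets sorted before `a` because those have strictly larger priority; strictness needs the distinct
priorities `hx`. A set leaving unselected failed the survival test, and later rounds only shrink it
further. -/
lemma ManisCoverage.step {z : ℝ} (hη : 0 < η) (hη' : η < 1 / 4) (h : ManisInv S A₀ B₀ s)
    (hc : ManisCoverage S η z A₀ B₀ s) (hθ : θ ≤ z)
    (hdeg : ∀ a, |deg a - (S a ∩ B₀).card| ≤ z)
    (hω : ∀ a, |(ω a).2.1| ≤ z ∧ |(ω a).2.2| ≤ z) (hx : Function.Injective fun a => (ω a).1) :
    ManisCoverage S η z A₀ B₀ (manisStep S η θ deg s ω) where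
  new := by
    refine PrefixAll.append hc.new ?_
    intro P a T hl
    have hmem : ∀ p, p = a ∨ p ∈ P → p ∈ s.A ∧ (1 - 4 * η) * deg p ≤
        ((picks S s.A s.B (fun a => (ω a).1) p).card : ℝ) + (ω p).2.1 := by
      intro p hp
      have : p ∈ P ++ a :: T := by
        rcases hp with rfl | hp <;> simp [*]
      rw [← hl, mem_sortByPriority] at this
      exact Finset.mem_filter.1 this
    have hnd := nodup_sortByPriority (fun a => (ω a).1) (s.A.filter fun a =>
      ((picks S s.A s.B (fun a => (ω a).1) a).card : ℝ) + (ω a).2.1 ≥ (1 - 4 * η) * deg a)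
    have hpw := pairwise_sortByPriority (fun a => (ω a).1) (s.A.filter fun a =>
      ((picks S s.A s.B (fun a => (ω a).1) a).card : ℝ) + (ω a).2.1 ≥ (1 - 4 * η) * deg a)
    have hlt : ∀ p ∈ P, (ω a).1 < (ω p).1 := by
      intro p hp
      have h1 : (ω a).1 ≤ (ω p).1 := by
        have := hl ▸ hpw
        exact (List.pairwise_append.1 this).2.2 p hp a (by simp)
      have h2 : p ≠ a := by
        have := hl ▸ hnd
        exact (List.nodup_append.1 this).2.2 p hp a (by simp)
      exact lt_of_le_of_ne h1 fun h3 => h2 (hx h3).symm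
    have hsub : picks S s.A s.B (fun a => (ω a).1) a ⊆
        (S a ∩ B₀) \ (s.out ++ P).toFinset.biUnion S := by
      intro b hb
      simp only [picks, Finset.mem_filter] at hb
      have hbB := hb.1
      rw [h.B_eq, Finset.mem_sdiff, Finset.mem_biUnion] at hbB
      simp only [Finset.mem_sdiff, Finset.mem_inter, Finset.mem_biUnion, List.mem_toFinset,
        List.mem_append]
      refine ⟨⟨hb.2.1, hbB.1⟩, ?_⟩
      rintro ⟨p, hp | hp, hbp⟩
      · exact hbB.2 ⟨p, by simpa using hp, hbp⟩
      · exact absurd (hb.2.2 p (hmem p (Or.inr hp)).1 hbp) (not_le.2 (hlt p hp))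
    have h3 : ((picks S s.A s.B (fun a => (ω a).1) a).card : ℝ) ≤
        ((S a ∩ B₀) \ (s.out ++ P).toFinset.biUnion S).card := by
      exact_mod_cast Finset.card_le_card hsub
    have h4 := (hmem a (Or.inl rfl)).2
    have h5 := abs_le.1 (hdeg a)
    have h6 := abs_le.1 (hω a).1
    refine le_trans ?_ h3
    -- The degree estimate costs `(1 - 4η) z` and the selection noise costs `z`, together at most
    -- `2z`.
    nlinarith
  dropped := by
    intro a ha
    have hB : (manisStep S η θ deg s ω).B ⊆ s.B := Finset.sdiff_subset
    have hz : 0 ≤ z := (abs_nonneg _).trans (hdeg a)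
    rcases hc.dropped a ha with h1 | h1 | h1
    · exact Or.inl (mem_out_manisStep.2 (Or.inl h1))
    · by_cases h2 : (1 - 4 * η) * deg a ≤
        ((picks S s.A s.B (fun a => (ω a).1) a).card : ℝ) + (ω a).2.1
      · exact Or.inl (mem_out_manisStep.2 (Or.inr ⟨h1, h2⟩))
      by_cases h3 : a ∈ (manisStep S η θ deg s ω).A
      · exact Or.inr (Or.inl h3)
      refine Or.inr (Or.inr ?_)
      have h4 : (((S a ∩ s.B) ∩ (manisStep S η θ deg s ω).B).card : ℝ) + (ω a).2.2 <
          (1 - η) * deg a + θ := by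
        by_contra h4
        refine h3 (Finset.mem_filter.2 ⟨Finset.mem_sdiff.2 ⟨h1, fun h5 => ?_⟩, not_lt.1 h4⟩)
        exact h2 (Finset.mem_filter.1 h5).2
      have h5 : (S a ∩ s.B) ∩ (manisStep S η θ deg s ω).B = S a ∩ (manisStep S η θ deg s ω).B := by
        rw [Finset.inter_assoc, Finset.inter_eq_right.2 hB]
      rw [h5] at h4
      have h6 := abs_le.1 (hdeg a)
      have h7 := abs_le.1 (hω a).2
      -- One `z` each for the degree estimate, the offset `θ` and the survival noise.
      nlinarith
    · refine Or.inr (Or.inr (le_trans ?_ h1))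
      exact_mod_cast Finset.card_le_card (Finset.inter_subset_inter_left hB)

lemma manisInv_init (S : Fin m → Finset (Fin N)) (A₀ : Finset (Fin m)) (B₀ : Finset (Fin N)) :
    ManisInv S A₀ B₀ { A := A₀, B := B₀, out := [] } :=
  ⟨by simp, by simp, by simp, by simp, by simp⟩

lemma manisInv_manisRun (ω : Fin R → RoundTape m) {r : ℕ} (hr : r ≤ R) :
    ManisInv S A₀ B₀ (manisRun S η θ deg { A := A₀, B := B₀, out := [] } ω r) := by
  induction r with
  | zero => rw [manisRun_zero]; exact manisInv_init S A₀ B₀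
  | succ r ih =>
    rw [manisRun_succ _ _ _ _ _ _ (Nat.lt_of_succ_le hr)]
    exact (ih (by omega)).step

lemma manisCoverage_manisRun {z : ℝ} (hη : 0 < η) (hη' : η < 1 / 4) (hθ : θ ≤ z)
    (hdeg : ∀ a, |deg a - (S a ∩ B₀).card| ≤ z) {ω : Fin R → RoundTape m}
    (hω : ∀ r a, |(ω r a).2.1| ≤ z ∧ |(ω r a).2.2| ≤ z)
    (hx : ∀ r, Function.Injective fun a => (ω r a).1) {r : ℕ} (hr : r ≤ R) :
    ManisCoverage S η z A₀ B₀ (manisRun S η θ deg { A := A₀, B := B₀, out := [] } ω r) := by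
  induction r with
  | zero =>
    rw [manisRun_zero]
    exact ⟨prefixAll_nil _, fun a ha => Or.inr (Or.inl ha)⟩
  | succ r ih =>
    rw [manisRun_succ _ _ _ _ _ _ (Nat.lt_of_succ_le hr)]
    exact ManisCoverage.step hη hη' (manisInv_manisRun ω (by omega)) (ih (by omega)) hθ hdeg
      (hω _) (hx _)

end

/-! ### Deterministic guarantees of the coverage algorithm -/

section

variable {m N R T : ℕ} (S : Fin m → Finset (Fin N)) (n : ℕ) (η C₁ K ε : ℝ)

open Classical in
/-- The sets on which the call of the phase with index `t` is made. -/
noncomputable def bucket (t : ℕ) (s : CoverState m N) (ν : Fin m → ℝ) : Finset (Fin m) :=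
  s.rem.filter fun a =>
    1 / (1 - η) ^ (t - 1) - K * Real.log n ^ 2 / eps0 n η ε ≤ ((S a ∩ s.U).card : ℝ) + ν a ∧
    ((S a ∩ s.U).card : ℝ) + ν a ≤ 1 / (1 - η) ^ t + K * Real.log n ^ 2 / eps0 n η ε

/-- The offset of the survival test in the calls made by the algorithm. -/
noncomputable def survivalOffset : ℝ :=
  6 * Real.log n / ((1 - 3 * η) * manisEps n C₁ (eps0 n η ε))

/-- The final state of the call made in the phase with index `t`. -/
noncomputable def phaseRun (t : ℕ) (s : CoverState m N) (ω : (Fin m → ℝ) × ManisTape m R) :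
    ManisState m N :=
  manisRun S η (survivalOffset n η C₁ ε) (fun a => ((S a ∩ s.U).card : ℝ) + ω.2.1 a)
    { A := bucket S n η K ε t s ω.1, B := s.U, out := [] } ω.2.2 R

lemma coverStep_eq (t : ℕ) (ω : (Fin m → ℝ) × ManisTape m R) (s : CoverState m N) :
    coverStep S n η C₁ K ε t ω s =
      { U := s.U \ (phaseRun S n η C₁ K ε t s ω).out.toFinset.biUnion S
        rem := s.rem \ (phaseRun S n η C₁ K ε t s ω).out.toFinset
        out := s.out ++ (phaseRun S n η C₁ K ε t s ω).out } := by
  have : manis S n η C₁ (eps0 n η ε) (bucket S n η K ε t s ω.1) s.U ω.2 =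
      (phaseRun S n η C₁ K ε t s ω).out := by
    rw [phaseRun, manisRun_all, manis]; rfl
  rw [← this]
  simp only [coverStep, bucket]

/-- The bookkeeping invariant of the algorithm. -/
structure CoverInv (s : CoverState m N) : Prop where
  nodup : s.out.Nodup
  mem_rem : ∀ a, a ∈ s.rem ↔ a ∉ s.out
  mem_U : ∀ b, b ∈ s.U ↔ ∀ a ∈ s.out, b ∉ S a

variable {S n η C₁ K ε}

lemma manisInv_phaseRun (t : ℕ) (s : CoverState m N) (ω : (Fin m → ℝ) × ManisTape m R) :
    ManisInv S (bucket S n η K ε t s ω.1) s.U (phaseRun S n η C₁ K ε t s ω) :=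
  manisInv_manisRun ω.2.2 le_rfl

lemma CoverInv.step {s : CoverState m N} (h : CoverInv S s) (t : ℕ)
    (ω : (Fin m → ℝ) × ManisTape m R) : CoverInv S (coverStep S n η C₁ K ε t ω s) := by
  have hm := manisInv_phaseRun (S := S) (n := n) (η := η) (C₁ := C₁) (K := K) (ε := ε) t s ω
  rw [coverStep_eq]
  refine ⟨List.Nodup.append h.nodup hm.nodup ?_, ?_, ?_⟩
  · intro a ha ha'
    exact (h.mem_rem a).1 (Finset.mem_filter.1 (hm.out_sub a ha')).1 ha
  · intro a
    simp only [Finset.mem_sdiff, h.mem_rem, List.mem_toFinset, List.mem_append, not_or]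
  · intro b
    simp only [Finset.mem_sdiff, h.mem_U, Finset.mem_biUnion, List.mem_toFinset, List.mem_append,
      not_exists, not_and]
    exact ⟨fun h1 a ha => ha.elim (h1.1 a) (h1.2 a),
      fun h1 => ⟨fun a ha => h1 a (Or.inl ha), fun a ha => h1 a (Or.inr ha)⟩⟩

lemma CoverInv.newCoverage_append {s : CoverState m N} (h : CoverInv S s) (P : List (Fin m))
    (a : Fin m) :
    newCoverage S (s.out ++ P) a = ((S a ∩ s.U) \ P.toFinset.biUnion S).card := by
  unfold newCoverage
  congr 1
  ext b
  simp only [Finset.mem_sdiff, Finset.mem_inter, h.mem_U, Finset.mem_biUnion, List.mem_toFinset,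
    List.mem_append, not_exists, not_and, and_assoc]
  refine and_congr_right fun _ => ?_
  exact ⟨fun h1 => ⟨fun a ha => h1 a (Or.inl ha), fun a ha => h1 a (Or.inr ha)⟩,
    fun h1 a ha => ha.elim (h1.1 a) (h1.2 a)⟩

/-- The greedy choice ranges over all sets; those already output cover nothing new, so a bound on
the remaining sets suffices. -/
lemma CoverInv.newCoverage_le {s : CoverState m N} (h : CoverInv S s) {x : ℝ} (hx : 0 ≤ x)
    (hle : ∀ a ∈ s.rem, ((S a ∩ s.U).card : ℝ) ≤ x) (P : List (Fin m)) (g : Fin m) :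
    (newCoverage S (s.out ++ P) g : ℝ) ≤ x := by
  rw [h.newCoverage_append]
  have h1 : (((S g ∩ s.U) \ P.toFinset.biUnion S).card : ℝ) ≤ (S g ∩ s.U).card := by
    exact_mod_cast Finset.card_le_card Finset.sdiff_subset
  by_cases hg : g ∈ s.rem
  · exact h1.trans (hle g hg)
  · have h2 : S g ∩ s.U = ∅ := by
      ext b
      simp only [Finset.mem_inter, h.mem_U, Finset.notMem_empty, iff_false, not_and]
      intro hb h3
      exact h3 g (by simpa [h.mem_rem] using hg) hb
    refine h1.trans ?_
    simpa [h2] using hx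

/-- The guarantee for an entry `a` preceded by `P`. -/
def NearGreedy (S : Fin m → Finset (Fin N)) (η v : ℝ) (P : List (Fin m)) (a : Fin m) : Prop :=
  ∀ g, (1 - 5 * η) * (newCoverage S P g : ℝ) - v ≤ (newCoverage S P a : ℝ)

/-- The draws of a phase have noise at most `z` and distinct priorities. -/
structure TameDraws (z : ℝ) (ω : (Fin m → ℝ) × ManisTape m R) : Prop where
  bucket_le : ∀ a, |ω.1 a| ≤ z
  deg_le : ∀ a, |ω.2.1 a| ≤ z
  round_le : ∀ r a, |(ω.2.2 r a).2.1| ≤ z ∧ |(ω.2.2 r a).2.2| ≤ z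
  inj : ∀ r, Function.Injective fun a => (ω.2.2 r a).1

/-- Compares the lower bucket bound for a chosen set with the invariant `hle`, which bounds every
greedy choice during the phase. The losses are `w` from `hle`, the bucket slack plus `z` from the
bucket test, and `2z` from the call. -/
lemma coverStep_prefixAll {s : CoverState m N} (h : CoverInv S s) (hη : 0 < η) (hη' : η < 1 / 5)
    {t : ℕ} {w z v : ℝ} {ω : (Fin m → ℝ) × ManisTape m R} (hω : TameDraws z ω)
    (hθ : survivalOffset n η C₁ ε ≤ z) (hw : 0 < w) (hz : 0 ≤ z)
    (hκ : w + z ≤ K * Real.log n ^ 2 / eps0 n η ε)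
    (hv : w + K * Real.log n ^ 2 / eps0 n η ε + 3 * z ≤ v)
    (hle : ∀ a ∈ s.rem, ((S a ∩ s.U).card : ℝ) ≤ 1 / (1 - η) ^ (t + 1) + w)
    (hnew : PrefixAll (NearGreedy S η v) s.out) :
    PrefixAll (NearGreedy S η v) (coverStep S n η C₁ K ε (t + 1) ω s).out := by
  rw [coverStep_eq]
  refine hnew.append ?_
  intro P a Q hl g
  have hη1 : 0 < 1 - η := by linarith
  have hm := manisInv_phaseRun (S := S) (n := n) (η := η) (C₁ := C₁) (K := K) (ε := ε) (t + 1) s ω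
  have hc : ManisCoverage S η z (bucket S n η K ε (t + 1) s ω.1) s.U
      (phaseRun S n η C₁ K ε (t + 1) s ω) :=
    manisCoverage_manisRun hη (by linarith) hθ (fun a => by simpa using hω.deg_le a)
      hω.round_le hω.inj le_rfl
  have h1 := hc.new P a Q hl
  have ha : a ∈ bucket S n η K ε (t + 1) s ω.1 := hm.out_sub a (by rw [hl]; simp)
  have h2 := (Finset.mem_filter.1 ha).2.1
  rw [Nat.add_sub_cancel] at h2
  have h3 := h.newCoverage_le (by positivity) hle P g
  rw [h.newCoverage_append P a]
  have h4 := abs_le.1 (hω.bucket_le a)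
  set q := 1 / (1 - η) ^ (t + 1) with hq
  have hq0 : 0 < q := by positivity
  have hq1 : 1 / (1 - η) ^ t = (1 - η) * q := by
    rw [hq, pow_succ]; field_simp
  rw [hq1] at h2
  set κ := K * Real.log n ^ 2 / eps0 n η ε
  set D : ℝ := ((S a ∩ s.U).card : ℝ)
  have h5 : (1 - η) * q - κ - z ≤ D := by linarith
  have h6 : (1 - 5 * η) * (newCoverage S (s.out ++ P) g : ℝ) ≤ (1 - 5 * η) * (q + w) :=
    mul_le_mul_of_nonneg_left h3 (by linarith)
  have h7 : (1 - 4 * η) * ((1 - η) * q - κ - z) ≤ (1 - 4 * η) * D :=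
    mul_le_mul_of_nonneg_left h5 (by linarith)
  -- The two sides differ by `4 η² q`; this is where `1 - 5η` comes from.
  have h8 : (1 - 5 * η) * q ≤ (1 - 4 * η) * ((1 - η) * q) := by nlinarith [sq_nonneg η]
  have h9 : (1 - 5 * η) * w ≤ w := by nlinarith
  have h10 : (1 - 4 * η) * (κ + z) ≤ κ + z := by nlinarith
  nlinarith

/-- After a phase the surviving sets are smaller by the factor `1 - η`. -/
lemma coverStep_card_le {s : CoverState m N} (hη : 0 < η) (hη' : η < 1 / 5)
    {t : ℕ} {w z : ℝ} {ω : (Fin m → ℝ) × ManisTape m R} (hω : TameDraws z ω)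
    (hθ : survivalOffset n η C₁ ε ≤ z) (hw : 0 ≤ w)
    (hκ : w + z ≤ K * Real.log n ^ 2 / eps0 n η ε)
    (hle : ∀ a ∈ s.rem, ((S a ∩ s.U).card : ℝ) ≤ 1 / (1 - η) ^ (t + 1) + w)
    (hdone : edges S (phaseRun S n η C₁ K ε (t + 1) s ω).A
      (phaseRun S n η C₁ K ε (t + 1) s ω).B = ∅)
    {a : Fin m} (ha : a ∈ (coverStep S n η C₁ K ε (t + 1) ω s).rem) :
    ((S a ∩ s.U).card : ℝ) < 1 / (1 - η) ^ t ∨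
      ((S a ∩ (coverStep S n η C₁ K ε (t + 1) ω s).U).card : ℝ) ≤
        (1 - η) * (S a ∩ s.U).card + 3 * z := by
  have hm := manisInv_phaseRun (S := S) (n := n) (η := η) (C₁ := C₁) (K := K) (ε := ε) (t + 1) s ω
  have hc : ManisCoverage S η z (bucket S n η K ε (t + 1) s ω.1) s.U
      (phaseRun S n η C₁ K ε (t + 1) s ω) :=
    manisCoverage_manisRun hη (by linarith) hθ (fun a => by simpa using hω.deg_le a)
      hω.round_le hω.inj le_rfl
  rw [coverStep_eq] at ha ⊢
  simp only [Finset.mem_sdiff, List.mem_toFinset] at ha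
  simp only
  have h4 := abs_le.1 (hω.bucket_le a)
  by_cases hb : a ∈ bucket S n η K ε (t + 1) s ω.1
  · right
    rw [← hm.B_eq]
    rcases hc.dropped a hb with h1 | h1 | h1
    · exact absurd h1 ha.2
    -- The set stayed active through all rounds; since no edge is left, it contains no uncovered
    -- element.
    · have h2 : S a ∩ (phaseRun S n η C₁ K ε (t + 1) s ω).B = ∅ := by
        ext b
        simp only [Finset.mem_inter, Finset.notMem_empty, iff_false, not_and]
        intro hbS hbB
        have : (a, b) ∈ edges S (phaseRun S n η C₁ K ε (t + 1) s ω).A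
            (phaseRun S n η C₁ K ε (t + 1) s ω).B :=
          Finset.mem_filter.2 ⟨Finset.mem_product.2 ⟨h1, hbB⟩, hbS⟩
        rw [hdone] at this
        exact absurd this (Finset.notMem_empty _)
      rw [h2, Finset.card_empty, Nat.cast_zero]
      have : 0 < 1 - η := by linarith
      have hz : 0 ≤ z := (abs_nonneg _).trans (hω.bucket_le a)
      positivity
    · exact h1
  -- By `hle` and `hκ` the upper bucket test cannot fail, and the lower one fails only for sets that
  -- are already small enough.
  · left
    by_contra hcon
    refine hb (Finset.mem_filter.2 ⟨ha.1, ?_, ?_⟩)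
    · rw [Nat.add_sub_cancel]
      rw [not_lt] at hcon
      linarith
    · linarith [hle a ha.1]

lemma coverStep_U_subset (s : CoverState m N) (t : ℕ) (ω : (Fin m → ℝ) × ManisTape m R) :
    (coverStep S n η C₁ K ε t ω s).U ⊆ s.U := by
  rw [coverStep_eq]; exact Finset.sdiff_subset

lemma coverStep_rem_subset (s : CoverState m N) (t : ℕ) (ω : (Fin m → ℝ) × ManisTape m R) :
    (coverStep S n η C₁ K ε t ω s).rem ⊆ s.rem := by
  rw [coverStep_eq]; exact Finset.sdiff_subset

/-- The condition `3z ≤ ηw` gives `(1 - η) w + 3z ≤ w`, so the additive error does not accumulate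
over the phases. -/
lemma coverStep_card_le_pow {s : CoverState m N} (hη : 0 < η) (hη' : η < 1 / 5)
    {t : ℕ} {w z : ℝ} {ω : (Fin m → ℝ) × ManisTape m R} (hω : TameDraws z ω)
    (hθ : survivalOffset n η C₁ ε ≤ z) (hw : 0 ≤ w) (hzw : 3 * z ≤ η * w)
    (hκ : w + z ≤ K * Real.log n ^ 2 / eps0 n η ε)
    (hle : ∀ a ∈ s.rem, ((S a ∩ s.U).card : ℝ) ≤ 1 / (1 - η) ^ (t + 1) + w)
    (hdone : edges S (phaseRun S n η C₁ K ε (t + 1) s ω).A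
      (phaseRun S n η C₁ K ε (t + 1) s ω).B = ∅)
    {a : Fin m} (ha : a ∈ (coverStep S n η C₁ K ε (t + 1) ω s).rem) :
    ((S a ∩ (coverStep S n η C₁ K ε (t + 1) ω s).U).card : ℝ) ≤ 1 / (1 - η) ^ t + w := by
  have h1 : ((S a ∩ (coverStep S n η C₁ K ε (t + 1) ω s).U).card : ℝ) ≤ (S a ∩ s.U).card := by
    exact_mod_cast Finset.card_le_card
      (Finset.inter_subset_inter_left (coverStep_U_subset s (t + 1) ω))
  have hη1 : 0 < 1 - η := by linarith
  rcases coverStep_card_le hη hη' hω hθ hw hκ hle hdone ha with h2 | h2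
  · linarith
  · have h3 := hle a (coverStep_rem_subset s (t + 1) ω ha)
    have hq : 1 / (1 - η) ^ t = (1 - η) * (1 / (1 - η) ^ (t + 1)) := by
      rw [pow_succ]; field_simp
    rw [hq]
    nlinarith [mul_le_mul_of_nonneg_left h3 hη1.le]

/-- The general bound `1 + w` is too weak when `w` is small. For `w < 1/4` integrality helps: a
remaining set had at most one element before the phase and has none after it. For `w ≥ 1/4`, `1 + w
≤ 5w`. -/
lemma coverStep_card_le_last {s : CoverState m N} (hη : 0 < η) (hη' : η < 1 / 5)
    {w z : ℝ} {ω : (Fin m → ℝ) × ManisTape m R} (hω : TameDraws z ω)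
    (hθ : survivalOffset n η C₁ ε ≤ z) (hw : 0 ≤ w) (hzw : 3 * z ≤ η * w)
    (hκ : w + z ≤ K * Real.log n ^ 2 / eps0 n η ε)
    (hle : ∀ a ∈ s.rem, ((S a ∩ s.U).card : ℝ) ≤ 1 / (1 - η) ^ (0 + 1) + w)
    (hdone : edges S (phaseRun S n η C₁ K ε (0 + 1) s ω).A
      (phaseRun S n η C₁ K ε (0 + 1) s ω).B = ∅)
    {a : Fin m} (ha : a ∈ (coverStep S n η C₁ K ε (0 + 1) ω s).rem) :
    ((S a ∩ (coverStep S n η C₁ K ε (0 + 1) ω s).U).card : ℝ) ≤ 5 * w := by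
  have hη1 : 0 < 1 - η := by linarith
  rcases lt_or_ge w (1 / 4) with hw4 | hw4
  · have hzero : (S a ∩ (coverStep S n η C₁ K ε (0 + 1) ω s).U).card < 1 := by
      rcases coverStep_card_le hη hη' hω hθ hw hκ hle hdone ha with h2 | h2
      · rw [pow_zero, div_one] at h2
        exact (Finset.card_le_card (Finset.inter_subset_inter_left
          (coverStep_U_subset s (0 + 1) ω))).trans_lt (by exact_mod_cast h2)
      · have h3 := hle a (coverStep_rem_subset s (0 + 1) ω ha)
        have h4 : 1 / (1 - η) ^ (0 + 1) < 5 / 4 := by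
          rw [zero_add, pow_one, div_lt_iff₀ hη1]; linarith
        have h5 : (S a ∩ s.U).card < 2 := by
          have : ((S a ∩ s.U).card : ℝ) < 2 := by linarith
          exact_mod_cast this
        have h6 : ((S a ∩ s.U).card : ℝ) ≤ 1 := by exact_mod_cast Nat.lt_succ_iff.1 h5
        have : ((S a ∩ (coverStep S n η C₁ K ε (0 + 1) ω s).U).card : ℝ) < 1 := by nlinarith
        exact_mod_cast this
    rw [Nat.lt_one_iff.1 hzero, Nat.cast_zero]
    positivity
  · have := coverStep_card_le_pow hη hη' hω hθ hw hzw hκ hle hdone ha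
    rw [pow_zero, div_one] at this
    linarith

/-! ### The whole run -/

variable (S n η C₁ K ε)

/-- The state after the first `j` phases. -/
noncomputable def coverRun (ω : CoverTape m T R) (j : ℕ) : CoverState m N :=
  ((List.finRange T).reverse.take j).foldl
    (fun s i => coverStep S n η C₁ K ε (i.val + 1) (ω i) s)
    { U := Finset.univ, rem := Finset.univ, out := [] }

lemma coverRun_zero (ω : CoverTape m T R) : coverRun S n η C₁ K ε ω 0 =
    { U := Finset.univ, rem := Finset.univ, out := [] } := by
  simp [coverRun]

/-- Phases run downwards: step `j` uses tape coordinate `T - (j + 1)`, whose phase index is one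
more, namely `T - j`. -/
lemma coverRun_succ (ω : CoverTape m T R) {j : ℕ} (hj : j < T) :
    coverRun S n η C₁ K ε ω (j + 1) = coverStep S n η C₁ K ε (T - (j + 1) + 1)
      (ω ⟨T - (j + 1), by omega⟩) (coverRun S n η C₁ K ε ω j) := by
  have h : (List.finRange T).reverse[j]? = some ⟨T - (j + 1), by omega⟩ := by
    rw [List.finRange_reverse, List.getElem?_map, List.getElem?_eq_getElem (by simpa using hj)]
    simp [Fin.rev]
  simp [coverRun, List.take_add_one, List.foldl_append, h]

lemma coverOutput_eq (ω : CoverTape m T R) : coverOutput S n η C₁ K ε ω =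
    (coverRun S n η C₁ K ε ω T).out ++
      (List.finRange m).filter fun a => a ∈ (coverRun S n η C₁ K ε ω T).rem := by
  have : (List.finRange T).reverse.take T = (List.finRange T).reverse :=
    List.take_of_length_le (by simp)
  rw [coverRun, this]
  unfold coverOutput
  congr!

lemma coverInv_coverRun (ω : CoverTape m T R) {j : ℕ} (hj : j ≤ T) :
    CoverInv S (coverRun S n η C₁ K ε ω j) := by
  induction j with
  | zero => rw [coverRun_zero]; exact ⟨by simp, by simp, by simp⟩
  | succ j ih =>
    rw [coverRun_succ _ _ _ _ _ _ _ (Nat.lt_of_succ_le hj)]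
    exact (ih (by omega)).step _ _

/-- Holds for every tape: the remaining sets are exactly those not yet output. -/
lemma perm_coverOutput (ω : CoverTape m T R) :
    (coverOutput S n η C₁ K ε ω).Perm (List.finRange m) := by
  have h := coverInv_coverRun S n η C₁ K ε ω le_rfl
  rw [coverOutput_eq]
  refine (List.perm_ext_iff_of_nodup ?_ (List.nodup_finRange m)).2 fun a => ?_
  · refine List.Nodup.append h.nodup ((List.nodup_finRange m).filter _) ?_
    intro a ha ha'
    have := (List.mem_filter.1 ha').2
    exact (h.mem_rem a).1 (by simpa using this) ha
  · simp [h.mem_rem, em]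

variable {S n η C₁ K ε}

/-- All phases behave well: tame draws, and no edge is left at the end of the calls. -/
structure GoodDraws (S : Fin m → Finset (Fin N)) (n : ℕ) (η C₁ K ε z : ℝ) (ω : CoverTape m T R) :
    Prop where
  tame : ∀ i, TameDraws z (ω i)
  done : ∀ j (hj : j < T), edges S
    (phaseRun S n η C₁ K ε (T - (j + 1) + 1) (coverRun S n η C₁ K ε ω j)
      (ω ⟨T - (j + 1), by omega⟩)).A
    (phaseRun S n η C₁ K ε (T - (j + 1) + 1) (coverRun S n η C₁ K ε ω j)
      (ω ⟨T - (j + 1), by omega⟩)).B = ∅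

section

variable {w z v : ℝ} {ω : CoverTape m T R}

lemma coverRun_card_le (hη : 0 < η) (hη' : η < 1 / 5) (hω : GoodDraws S n η C₁ K ε z ω)
    (hθ : survivalOffset n η C₁ ε ≤ z) (hw : 0 ≤ w) (hzw : 3 * z ≤ η * w)
    (hκ : w + z ≤ K * Real.log n ^ 2 / eps0 n η ε) (hT : (N : ℝ) ≤ 1 / (1 - η) ^ T)
    {j : ℕ} (hj : j ≤ T) : ∀ a ∈ (coverRun S n η C₁ K ε ω j).rem,
      ((S a ∩ (coverRun S n η C₁ K ε ω j).U).card : ℝ) ≤ 1 / (1 - η) ^ (T - j) + w := by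
  induction j with
  | zero =>
    intro a _
    have : ((S a ∩ (coverRun S n η C₁ K ε ω 0).U).card : ℝ) ≤ N := by
      exact_mod_cast (Finset.card_le_univ _).trans (by simp)
    rw [Nat.sub_zero]
    linarith
  | succ j ih =>
    intro a ha
    have hjT := Nat.lt_of_succ_le hj
    rw [coverRun_succ _ _ _ _ _ _ _ hjT] at ha ⊢
    refine coverStep_card_le_pow hη hη' (hω.tame _) hθ hw hzw hκ ?_ (hω.done j hjT) ha
    rw [show T - (j + 1) + 1 = T - j by omega]
    exact ih hjT.le

lemma coverRun_prefixAll (hη : 0 < η) (hη' : η < 1 / 5) (hω : GoodDraws S n η C₁ K ε z ω)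
    (hθ : survivalOffset n η C₁ ε ≤ z) (hw : 0 < w) (hz : 0 ≤ z) (hzw : 3 * z ≤ η * w)
    (hκ : w + z ≤ K * Real.log n ^ 2 / eps0 n η ε) (hT : (N : ℝ) ≤ 1 / (1 - η) ^ T)
    (hv : w + K * Real.log n ^ 2 / eps0 n η ε + 3 * z ≤ v) {j : ℕ} (hj : j ≤ T) :
    PrefixAll (NearGreedy S η v) (coverRun S n η C₁ K ε ω j).out := by
  induction j with
  | zero => rw [coverRun_zero]; exact prefixAll_nil _
  | succ j ih =>
    have hjT := Nat.lt_of_succ_le hj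
    rw [coverRun_succ _ _ _ _ _ _ _ hjT]
    refine coverStep_prefixAll (coverInv_coverRun S n η C₁ K ε ω hjT.le) hη hη' (hω.tame _) hθ hw
      hz hκ hv ?_ (ih hjT.le)
    rw [show T - (j + 1) + 1 = T - j by omega]
    exact coverRun_card_le hη hη' hω hθ hw.le hzw hκ hT hjT.le

lemma coverOutput_prefixAll (hη : 0 < η) (hη' : η < 1 / 5) (hω : GoodDraws S n η C₁ K ε z ω)
    (hθ : survivalOffset n η C₁ ε ≤ z) (hw : 0 < w) (hz : 0 ≤ z) (hzw : 3 * z ≤ η * w)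
    (hκ : w + z ≤ K * Real.log n ^ 2 / eps0 n η ε) (hT : (N : ℝ) ≤ 1 / (1 - η) ^ T) (hT0 : 0 < T)
    (hv : w + K * Real.log n ^ 2 / eps0 n η ε + 3 * z ≤ v) (hv' : 5 * w ≤ v) :
    PrefixAll (NearGreedy S η v) (coverOutput S n η C₁ K ε ω) := by
  rw [coverOutput_eq]
  refine (coverRun_prefixAll hη hη' hω hθ hw hz hzw hκ hT hv le_rfl).append ?_
  intro P a Q _ g
  have hlast : ∀ a ∈ (coverRun S n η C₁ K ε ω T).rem,
      ((S a ∩ (coverRun S n η C₁ K ε ω T).U).card : ℝ) ≤ 5 * w := by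
    intro a ha
    obtain ⟨t, rfl⟩ : ∃ t, T = t + 1 := ⟨T - 1, by omega⟩
    have h1 := coverRun_card_le hη hη' hω hθ hw.le hzw hκ hT (Nat.le_succ t)
    have h2 := hω.done t (Nat.lt_succ_self t)
    rw [coverRun_succ _ _ _ _ _ _ _ (Nat.lt_succ_self t)] at ha ⊢
    have h3 := hω.tame ⟨t + 1 - (t + 1), by omega⟩
    revert h1 h2 h3 ha
    -- Hides the dependent index so that the phase number can be rewritten to `0 + 1`.
    generalize ω ⟨t + 1 - (t + 1), by omega⟩ = τ
    rw [Nat.sub_self, show t + 1 - t = 0 + 1 by omega]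
    intro ha h1 h2 h3
    exact coverStep_card_le_last hη hη' h3 hθ hw.le hzw hκ h1 h2 ha
  have h1 := (coverInv_coverRun S n η C₁ K ε ω le_rfl).newCoverage_le (by positivity) hlast P g
  have h2 : (0 : ℝ) ≤ newCoverage S ((coverRun S n η C₁ K ε ω T).out ++ P) g := Nat.cast_nonneg _
  have h3 : (0 : ℝ) ≤ newCoverage S ((coverRun S n η C₁ K ε ω T).out ++ P) a := Nat.cast_nonneg _
  -- After the last phase every new coverage is at most `5w ≤ v`, so the guarantee for the leftover
  -- sets asks for nothing positive.
  nlinarith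

end

lemma PrefixAll.getElem {α : Type*} {Q : List α → α → Prop} {l : List α} (h : PrefixAll Q l)
    (i : ℕ) (hi : i < l.length) : Q (l.take i) l[i] :=
  h _ _ (l.drop (i + 1)) (by simp)

/-- The coefficients are constant, so every running average equals `1 - 5η`. -/
lemma PrefixAll.isPrefixOptimal {l : List (Fin m)} {v : ℝ}
    (h : PrefixAll (NearGreedy S η v) l) : IsPrefixOptimal S (1 - 5 * η) v l := by
  refine ⟨fun _ => 1 - 5 * η, fun i hi => ⟨?_, fun g _ => h.getElem i hi g⟩⟩
  rw [Finset.sum_const, Finset.card_range, nsmul_eq_mul, le_div_iff₀ (by positivity)]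
  push_cast
  linarith

end

/-! ### Failure probabilities -/

lemma measure_pi_exists_le {ι α : Type*} [Fintype ι] [MeasurableSpace α] (μ : ι → Measure α)
    [∀ i, IsProbabilityMeasure (μ i)] (E : ι → Set α) :
    Measure.pi μ {ω | ∃ i, ω i ∈ E i} ≤ ∑ i, μ i (E i) := by
  classical
  have : {ω : ι → α | ∃ i, ω i ∈ E i} =
      ⋃ i, Set.univ.pi (Function.update (fun _ => Set.univ) i (E i)) := by
    ext ω
    simp [Set.univ_pi_update_univ]
  rw [this]
  refine (measure_iUnion_fintype_le _ _).trans (Finset.sum_le_sum fun i _ => ?_)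
  rw [Measure.pi_pi, ← Finset.mul_prod_erase _ _ (Finset.mem_univ i), Function.update_self,
    Finset.prod_eq_one, mul_one]
  intro j hj
  rw [Function.update_of_ne (Finset.ne_of_mem_erase hj), measure_univ]

lemma measure_prod_or_le {α β : Type*} [MeasurableSpace α] [MeasurableSpace β] (μ : Measure α)
    [IsProbabilityMeasure μ] (ν : Measure β) [IsProbabilityMeasure ν] (E : Set α) (F : Set β) :
    μ.prod ν {p | p.1 ∈ E ∨ p.2 ∈ F} ≤ μ E + ν F := by
  have : {p : α × β | p.1 ∈ E ∨ p.2 ∈ F} = E ×ˢ Set.univ ∪ Set.univ ×ˢ F := by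
    ext p; simp
  rw [this]
  refine (measure_union_le _ _).trans ?_
  rw [Measure.prod_prod, Measure.prod_prod, measure_univ, measure_univ, mul_one, one_mul]

/-- Given `x_{a'}`, the independent draw `x_a` would have to hit a single point; there are finitely
many pairs. -/
lemma roundLaw_tie_eq_zero (m : ℕ) {β : ℝ} (hβ : 0 < β) :
    roundLaw m β {ω | ¬ Function.Injective fun a => (ω a).1} = 0 := by
  have := isProbabilityMeasure_laplace hβ
  have h : {ω : RoundTape m | ¬ Function.Injective fun a => (ω a).1} ⊆
      ⋃ a : Fin m, ⋃ a' : Fin m, {ω | a ≠ a' ∧ (ω a).1 = (ω a').1} := by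
    intro ω hω
    simp only [Set.mem_ofPred_eq, Function.Injective, not_forall] at hω
    obtain ⟨a, a', h1, h2⟩ := hω
    simp only [Set.mem_iUnion]
    exact ⟨a, a', h2, h1⟩
  refine measure_mono_null h (measure_iUnion_null fun a => measure_iUnion_null fun a' => ?_)
  by_cases hne : a = a'
  · simp [hne]
  have hE : MeasurableSet {p : ℝ × (ℝ × ℝ × ℝ) | p.2.1 = p.1} :=
    measurableSet_eq_fun measurable_snd.fst measurable_fst
  have h1 := measure_pi_of_update_le
    (fun _ : Fin m => uniform01.prod ((laplace β).prod (laplace β))) a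
    (f := fun ω => (ω a').1) (measurable_pi_apply a').fst
    (fun ω y => by rw [Function.update_of_ne (Ne.symm hne)]) hE (p := 0) fun s => by
      have : {y : ℝ × ℝ × ℝ | (s, y) ∈ {p : ℝ × (ℝ × ℝ × ℝ) | p.2.1 = p.1}} = {s} ×ˢ Set.univ := by
        ext y; simp
      rw [this, Measure.prod_prod, uniform01_singleton, zero_mul]
  refine le_antisymm (le_trans (measure_mono ?_) h1) zero_le
  intro ω hω
  exact hω.2

lemma roundLaw_untame_le (m : ℕ) {β z : ℝ} (hβ : 0 < β) (hz : 0 ≤ z) :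
    roundLaw m β {ω | ¬ ((∀ a, |(ω a).2.1| ≤ z ∧ |(ω a).2.2| ≤ z) ∧
      Function.Injective fun a => (ω a).1)} ≤ m * (2 * ENNReal.ofReal (Real.exp (-z / β))) := by
  have := isProbabilityMeasure_laplace hβ
  have h : {ω : RoundTape m | ¬ ((∀ a, |(ω a).2.1| ≤ z ∧ |(ω a).2.2| ≤ z) ∧
      Function.Injective fun a => (ω a).1)} ⊆
      {ω | ∃ a, ω a ∈ (Set.univ : Set ℝ) ×ˢ
        {p : ℝ × ℝ | p.1 ∈ {x : ℝ | z < |x|} ∨ p.2 ∈ {x : ℝ | z < |x|}}} ∪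
      {ω | ¬ Function.Injective fun a => (ω a).1} := by
    intro ω hω
    by_cases hi : Function.Injective fun a => (ω a).1
    · left
      by_contra hcon
      refine hω ⟨fun a => ?_, hi⟩
      constructor
      · by_contra h1
        exact hcon ⟨a, trivial, Or.inl (not_le.1 h1)⟩
      · by_contra h1
        exact hcon ⟨a, trivial, Or.inr (not_le.1 h1)⟩
    · exact Or.inr hi
  refine (measure_mono h).trans ((measure_union_le _ _).trans ?_)
  rw [roundLaw_tie_eq_zero m hβ, add_zero]
  refine (measure_pi_exists_le _ _).trans ?_
  rw [Finset.sum_const, Finset.card_univ, Fintype.card_fin, nsmul_eq_mul, Measure.prod_prod,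
    measure_univ, one_mul]
  refine mul_le_mul_right ((measure_prod_or_le _ _ _ _).trans ?_) _
  rw [two_mul]
  exact add_le_add (laplace_abs_gt_le hβ hz) (laplace_abs_gt_le hβ hz)

/-- The law of the draws of one phase. -/
noncomputable def phaseLaw (m R n : ℕ) (C₁ ε : ℝ) : Measure ((Fin m → ℝ) × ManisTape m R) :=
  (Measure.pi fun _ : Fin m => laplace (1 / ε)).prod (manisLaw m R n C₁ ε)

lemma manisLaw_eq (m R n : ℕ) (C₁ ε : ℝ) : manisLaw m R n C₁ ε =
    (Measure.pi fun _ : Fin m => laplace (2 / manisEps n C₁ ε)).prod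
      (Measure.pi fun _ : Fin R => roundLaw m (1 / manisEps n C₁ ε)) := rfl

lemma isProbabilityMeasure_manisLaw (m R : ℕ) {n : ℕ} {C₁ ε : ℝ} (h : 0 < manisEps n C₁ ε) :
    IsProbabilityMeasure (manisLaw m R n C₁ ε) := by
  have := isProbabilityMeasure_laplace (div_pos two_pos h)
  have := isProbabilityMeasure_roundLaw m (one_div_pos.2 h)
  rw [manisLaw_eq]; infer_instance

lemma isProbabilityMeasure_phaseLaw (m R : ℕ) {n : ℕ} {C₁ ε : ℝ} (hε : 0 < ε)
    (h : 0 < manisEps n C₁ ε) : IsProbabilityMeasure (phaseLaw m R n C₁ ε) := by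
  have := isProbabilityMeasure_laplace (one_div_pos.2 hε)
  have := isProbabilityMeasure_manisLaw m R h
  unfold phaseLaw; infer_instance

/-- `z` is at least `u` times each of the scales `1/ε`, `2/δ`, `1/δ`, so each noise value exceeds it
with probability at most `exp (-u)`. A set has `2 + 2R` noise values per phase. -/
lemma phaseLaw_untame_le (m R : ℕ) {n : ℕ} {C₁ ε z u : ℝ} (hε : 0 < ε)
    (h : 0 < manisEps n C₁ ε) (hu : 0 ≤ u) (hz1 : u / ε ≤ z) (hz2 : 2 * u / manisEps n C₁ ε ≤ z) :
    phaseLaw m R n C₁ ε {ω | ¬ TameDraws z ω} ≤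
      (m * (2 + 2 * R) : ℕ) * ENNReal.ofReal (Real.exp (-u)) := by
  have := isProbabilityMeasure_laplace (one_div_pos.2 hε)
  have := isProbabilityMeasure_laplace (div_pos two_pos h)
  have := isProbabilityMeasure_roundLaw m (one_div_pos.2 h)
  have := isProbabilityMeasure_manisLaw m R h
  have hz : 0 ≤ z := (div_nonneg hu hε.le).trans hz1
  set E : Set (Fin m → ℝ) := {ν | ∃ a, ν a ∈ {x : ℝ | z < |x|}}
  set G : Set (Fin R → RoundTape m) := {ω | ∃ r, ω r ∈ {ω : RoundTape m |
    ¬ ((∀ a, |(ω a).2.1| ≤ z ∧ |(ω a).2.2| ≤ z) ∧ Function.Injective fun a => (ω a).1)}}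
  have hsub : {ω : (Fin m → ℝ) × ManisTape m R | ¬ TameDraws z ω} ⊆
      {ω | ω.1 ∈ E ∨ ω.2 ∈ {ω : ManisTape m R | ω.1 ∈ E ∨ ω.2 ∈ G}} := by
    intro ω hω
    by_contra hcon
    have h1 : ω.1 ∉ E := fun h => hcon (Or.inl h)
    have h2 : ω.2.1 ∉ E := fun h => hcon (Or.inr (Or.inl h))
    have h3 : ω.2.2 ∉ G := fun h => hcon (Or.inr (Or.inr h))
    have h4 : ∀ r, (∀ a, |(ω.2.2 r a).2.1| ≤ z ∧ |(ω.2.2 r a).2.2| ≤ z) ∧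
        Function.Injective fun a => (ω.2.2 r a).1 := fun r => by
      by_contra h5; exact h3 ⟨r, h5⟩
    exact hω ⟨fun a => not_lt.1 fun h5 => h1 ⟨a, h5⟩, fun a => not_lt.1 fun h5 => h2 ⟨a, h5⟩,
      fun r => (h4 r).1, fun r => (h4 r).2⟩
  have hexp : ∀ {β : ℝ}, 0 < β → u * β ≤ z → Real.exp (-z / β) ≤ Real.exp (-u) := by
    intro β hβ hle
    refine Real.exp_le_exp.2 ?_
    rw [div_le_iff₀ hβ]; linarith
  have hlap : ∀ {β : ℝ} (hβ : 0 < β), u * β ≤ z →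
      (Measure.pi fun _ : Fin m => laplace β) E ≤ m * ENNReal.ofReal (Real.exp (-u)) := by
    intro β hβ hle
    have := isProbabilityMeasure_laplace hβ
    refine (measure_pi_exists_le _ _).trans ?_
    rw [Finset.sum_const, Finset.card_univ, Fintype.card_fin, nsmul_eq_mul]
    exact mul_le_mul_right ((laplace_abs_gt_le hβ hz).trans
      (ENNReal.ofReal_le_ofReal (hexp hβ hle))) _
  have hG : (Measure.pi fun _ : Fin R => roundLaw m (1 / manisEps n C₁ ε)) G ≤
      R * (m * (2 * ENNReal.ofReal (Real.exp (-u)))) := by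
    refine (measure_pi_exists_le _ _).trans ?_
    rw [Finset.sum_const, Finset.card_univ, Fintype.card_fin, nsmul_eq_mul]
    refine mul_le_mul_right ((roundLaw_untame_le m (one_div_pos.2 h) hz).trans ?_) _
    refine mul_le_mul_right (mul_le_mul_right (ENNReal.ofReal_le_ofReal
      (hexp (one_div_pos.2 h) ?_)) _) _
    refine le_trans ?_ hz2
    rw [mul_one_div]
    exact div_le_div_of_nonneg_right (by linarith) h.le
  refine (measure_mono hsub).trans ((measure_prod_or_le _ _ _ _).trans ?_)
  rw [manisLaw_eq]
  refine (add_le_add (hlap (one_div_pos.2 hε) (by rwa [mul_one_div])) ((measure_prod_or_le _ _ _ _).trans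
    (add_le_add (hlap (div_pos two_pos h) ?_) hG))).trans (le_of_eq ?_)
  · rwa [← mul_div_assoc, mul_comm u]
  · push_cast; ring

/-! ### Union bound over the phases -/

section

variable {m N R T : ℕ} (S : Fin m → Finset (Fin N)) (n : ℕ) {η C₁ K ε : ℝ}

lemma measurable_phaseRun {Z : Type*} [MeasurableSpace Z] (η C₁ K ε : ℝ) (t : ℕ)
    {s : Z → CoverState m N} {ω : Z → (Fin m → ℝ) × ManisTape m R} (hs : Measurable s)
    (hω : Measurable ω) : Measurable fun z => phaseRun S n η C₁ K ε t (s z) (ω z) := by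
  have hj : Measurable fun p : CoverState m N × ((Fin m → ℝ) × ManisTape m R) =>
      phaseRun S n η C₁ K ε t p.1 p.2 := by
    refine measurable_from_prod_countable_right fun s => ?_
    have hb : Measurable fun ω : (Fin m → ℝ) × ManisTape m R => bucket S n η K ε t s ω.1 := by
      have h : ∀ a, Measurable fun ω : (Fin m → ℝ) × ManisTape m R =>
          1 / (1 - η) ^ (t - 1) - K * Real.log n ^ 2 / eps0 n η ε ≤
            ((S a ∩ s.U).card : ℝ) + ω.1 a ∧
          ((S a ∩ s.U).card : ℝ) + ω.1 a ≤
            1 / (1 - η) ^ t + K * Real.log n ^ 2 / eps0 n η ε := by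
        intro a
        have h1 : Measurable fun ω : (Fin m → ℝ) × ManisTape m R =>
            ((S a ∩ s.U).card : ℝ) + ω.1 a :=
          ((measurable_pi_apply a).comp measurable_fst).const_add _
        exact Measurable.and (measurableSet_setOfPred.1 (measurableSet_le measurable_const h1))
          (measurableSet_setOfPred.1 (measurableSet_le h1 measurable_const))
      exact measurable_finset_filter s.rem fun a _ => h a
    have hi : Measurable fun ω : (Fin m → ℝ) × ManisTape m R =>
        ({ A := bucket S n η K ε t s ω.1, B := s.U, out := [] } : ManisState m N) :=
      (Measurable.of_discrete (f := fun A : Finset (Fin m) =>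
        ({ A := A, B := s.U, out := [] } : ManisState m N))).comp hb
    have hd : Measurable fun ω : (Fin m → ℝ) × ManisTape m R =>
        fun a => ((S a ∩ s.U).card : ℝ) + ω.2.1 a :=
      measurable_pi_iff.2 fun a =>
        ((measurable_pi_apply a).comp measurable_snd.fst).const_add _
    exact measurable_manisRun S η (survivalOffset n η C₁ ε) hd hi measurable_snd.snd le_rfl
  have hc := hj.comp (hs.prodMk hω)
  exact hc

lemma measurable_coverStep {Z : Type*} [MeasurableSpace Z] (η C₁ K ε : ℝ) (t : ℕ)
    {s : Z → CoverState m N} {ω : Z → (Fin m → ℝ) × ManisTape m R} (hs : Measurable s)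
    (hω : Measurable ω) : Measurable fun z => coverStep S n η C₁ K ε t (ω z) (s z) := by
  simp only [coverStep_eq]
  have hF : Measurable fun p : CoverState m N × ManisState m N =>
      ({ U := p.1.U \ p.2.out.toFinset.biUnion S
         rem := p.1.rem \ p.2.out.toFinset
         out := p.1.out ++ p.2.out } : CoverState m N) := Measurable.of_discrete
  have hc := hF.comp (hs.prodMk (measurable_phaseRun S n η C₁ K ε t hs hω))
  exact hc

lemma measurable_coverRun (η C₁ K ε : ℝ) {j : ℕ} (hj : j ≤ T) :
    Measurable fun ω : CoverTape m T R => coverRun S n η C₁ K ε ω j := by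
  induction j with
  | zero => simp only [coverRun_zero]; exact measurable_const
  | succ j ih =>
    simp only [coverRun_succ _ _ _ _ _ _ _ (Nat.lt_of_succ_le hj)]
    exact measurable_coverStep S n η C₁ K ε _ (ih (by omega)) (measurable_pi_apply _)

/-- The first `j` phases read only the top `j` coordinates of the tape. -/
lemma coverRun_update (η C₁ K ε : ℝ) (ω : CoverTape m T R) (i : Fin T)
    (y : (Fin m → ℝ) × ManisTape m R) {j : ℕ} (hj : j + i < T) :
    coverRun S n η C₁ K ε (Function.update ω i y) j = coverRun S n η C₁ K ε ω j := by
  induction j with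
  | zero => simp only [coverRun_zero]
  | succ j ih =>
    have hjT : j < T := by omega
    rw [coverRun_succ _ _ _ _ _ _ _ hjT, coverRun_succ _ _ _ _ _ _ _ hjT, ih (by omega),
      Function.update_of_ne]
    intro h
    have := congrArg Fin.val h
    simp only at this
    omega

/-- The decay bound holds for every initial bucket and all degree estimates, so one may condition on
the bucket and degree noise. -/
lemma phaseLaw_edges_nonempty_le (hε : 0 < eps0 n η ε) (h : 0 < manisEps n C₁ (eps0 n η ε))
    (hη : 0 < η) (hη' : η < 1 / 4) (hθ : 0 ≤ survivalOffset n η C₁ ε) (t : ℕ)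
    (s : CoverState m N) :
    phaseLaw m R n C₁ (eps0 n η ε) {ω | (edges S (phaseRun S n η C₁ K ε t s ω).A
      (phaseRun S n η C₁ K ε t s ω).B).Nonempty} ≤
      ENNReal.ofReal (1 - decayRate η) ^ R * (m * N : ℕ) := by
  have := isProbabilityMeasure_laplace (one_div_pos.2 hε)
  have := isProbabilityMeasure_laplace (div_pos two_pos h)
  have := isProbabilityMeasure_roundLaw m (one_div_pos.2 h)
  have := isProbabilityMeasure_manisLaw m R h
  have hm : MeasurableSet {ω : (Fin m → ℝ) × ManisTape m R |
      (edges S (phaseRun S n η C₁ K ε t s ω).A (phaseRun S n η C₁ K ε t s ω).B).Nonempty} :=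
    (measurable_phaseRun S n η C₁ K ε t measurable_const measurable_id)
      (MeasurableSet.of_discrete (s := {t : ManisState m N | (edges S t.A t.B).Nonempty}))
  have hm' : ∀ ν : Fin m → ℝ, MeasurableSet {ω : ManisTape m R |
      (edges S (phaseRun S n η C₁ K ε t s (ν, ω)).A
        (phaseRun S n η C₁ K ε t s (ν, ω)).B).Nonempty} := fun ν => measurable_prodMk_left hm
  have key : ∀ (ν d : Fin m → ℝ), (Measure.pi fun _ : Fin R =>
      roundLaw m (1 / manisEps n C₁ (eps0 n η ε))) {ρ : Fin R → RoundTape m |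
      (edges S (phaseRun S n η C₁ K ε t s (ν, (d, ρ))).A
        (phaseRun S n η C₁ K ε t s (ν, (d, ρ))).B).Nonempty} ≤
      ENNReal.ofReal (1 - decayRate η) ^ R * (m * N : ℕ) := by
    intro ν d
    have := measure_edges_manisRun_nonempty_le (R := R) S (one_div_pos.2 h) hη hη' hθ
      (fun a => ((S a ∩ s.U).card : ℝ) + d a)
      { A := bucket S n η K ε t s ν, B := s.U, out := [] }
    simp only [phaseRun]
    exact this
  have key' : ∀ ν : Fin m → ℝ, manisLaw m R n C₁ (eps0 n η ε) {ω : ManisTape m R |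
      (edges S (phaseRun S n η C₁ K ε t s (ν, ω)).A
        (phaseRun S n η C₁ K ε t s (ν, ω)).B).Nonempty} ≤
      ENNReal.ofReal (1 - decayRate η) ^ R * (m * N : ℕ) := by
    intro ν
    rw [manisLaw_eq]
    exact measure_prod_le_of_slice_le _ _ (hm' ν) (key ν)
  exact measure_prod_le_of_slice_le _ _ hm key'

lemma coverLaw_eq (m n : ℕ) (η C₁ C₂ ε : ℝ) : coverLaw m n η C₁ C₂ ε =
    Measure.pi fun _ : Fin (phases n η) =>
      phaseLaw m (manisRounds n C₂) n C₁ (eps0 n η ε) := rfl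

/-- Whether a call leaves an edge depends on earlier phases only through the state, which is
independent of the draws of the call; the bound uniform in the state therefore applies to each
phase. -/
lemma measure_not_goodDraws_le (hε : 0 < eps0 n η ε) (h : 0 < manisEps n C₁ (eps0 n η ε))
    (hη : 0 < η) (hη' : η < 1 / 4) (hθ : 0 ≤ survivalOffset n η C₁ ε) {u z : ℝ} (hu : 0 ≤ u)
    (hz1 : u / eps0 n η ε ≤ z) (hz2 : 2 * u / manisEps n C₁ (eps0 n η ε) ≤ z) :
    (Measure.pi fun _ : Fin T => phaseLaw m R n C₁ (eps0 n η ε))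
      {ω | ¬ GoodDraws S n η C₁ K ε z ω} ≤
      T * ((m * (2 + 2 * R) : ℕ) * ENNReal.ofReal (Real.exp (-u))) +
      T * (ENNReal.ofReal (1 - decayRate η) ^ R * (m * N : ℕ)) := by
  have := isProbabilityMeasure_phaseLaw m R hε h
  set F : Fin T → Set (CoverTape m T R) := fun j => {ω | (edges S
    (phaseRun S n η C₁ K ε (T - (j + 1) + 1) (coverRun S n η C₁ K ε ω j)
      (ω ⟨T - (j + 1), by omega⟩)).A
    (phaseRun S n η C₁ K ε (T - (j + 1) + 1) (coverRun S n η C₁ K ε ω j)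
      (ω ⟨T - (j + 1), by omega⟩)).B).Nonempty} with hF
  have hsub : {ω : CoverTape m T R | ¬ GoodDraws S n η C₁ K ε z ω} ⊆
      {ω | ∃ i, ω i ∈ {τ : (Fin m → ℝ) × ManisTape m R | ¬ TameDraws z τ}} ∪ ⋃ j, F j := by
    intro ω hω
    by_contra hcon
    refine hω ⟨fun i => ?_, fun j hj => ?_⟩
    · by_contra h1; exact hcon (Or.inl ⟨i, h1⟩)
    · rw [← Finset.not_nonempty_iff_eq_empty]
      exact fun h1 => hcon (Or.inr (Set.mem_iUnion.2 ⟨⟨j, hj⟩, h1⟩))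
  refine (measure_mono hsub).trans ((measure_union_le _ _).trans (add_le_add ?_ ?_))
  · refine (measure_pi_exists_le _ _).trans ?_
    rw [Finset.sum_const, Finset.card_univ, Fintype.card_fin, nsmul_eq_mul]
    exact mul_le_mul_right (phaseLaw_untame_le m R hε h hu hz1 hz2) _
  · refine (measure_iUnion_fintype_le _ _).trans ?_
    refine (Finset.sum_le_sum (g := fun _ => ENNReal.ofReal (1 - decayRate η) ^ R * (m * N : ℕ))
      fun j _ => ?_).trans (le_of_eq ?_)
    · have hE : MeasurableSet {p : CoverState m N × ((Fin m → ℝ) × ManisTape m R) |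
          (edges S (phaseRun S n η C₁ K ε (T - (j + 1) + 1) p.1 p.2).A
            (phaseRun S n η C₁ K ε (T - (j + 1) + 1) p.1 p.2).B).Nonempty} :=
        (measurable_phaseRun S n η C₁ K ε _ measurable_fst measurable_snd)
          (MeasurableSet.of_discrete (s := {t : ManisState m N | (edges S t.A t.B).Nonempty}))
      exact measure_pi_of_update_le (fun _ : Fin T => phaseLaw m R n C₁ (eps0 n η ε))
        ⟨T - (j + 1), by omega⟩ (measurable_coverRun S n η C₁ K ε j.2.le)
        (fun ω y => coverRun_update S n η C₁ K ε ω _ y (by simp only; omega)) hE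
        (fun s => phaseLaw_edges_nonempty_le S n hε h hη hη' hθ _ s)
    · rw [Finset.sum_const, Finset.card_univ, Fintype.card_fin, nsmul_eq_mul]

end

/-! ### Constants -/

/-- Lets additive constants be absorbed into multiples of `log n`, down to `n = 2`. -/
lemma half_lt_log {n : ℕ} (hn : 2 ≤ n) : 1 / 2 < Real.log n := by
  have h1 : Real.log 2 ≤ Real.log n :=
    Real.log_le_log (by norm_num) (by exact_mod_cast hn)
  linarith [Real.log_two_gt_d9]

lemma one_lt_one_div_one_sub {η : ℝ} (hη : 0 < η) (hη' : η < 1) : 1 < 1 / (1 - η) := by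
  rw [lt_div_iff₀ (by linarith)]; linarith

lemma phases_pos {n : ℕ} (hn : 2 ≤ n) {η : ℝ} (hη : 0 < η) (hη' : η < 1) : 0 < phases n η :=
  Nat.ceil_pos.2 (Real.logb_pos (one_lt_one_div_one_sub hη hη') (by exact_mod_cast hn))

lemma le_one_div_pow_phases {n : ℕ} (hn : 2 ≤ n) {η : ℝ} (hη : 0 < η) (hη' : η < 1) :
    (n : ℝ) ≤ 1 / (1 - η) ^ phases n η := by
  have h1 := one_lt_one_div_one_sub hη hη'
  have hn0 : (0 : ℝ) < n := by positivity
  have h2 := Nat.le_ceil (Real.logb (1 / (1 - η)) n)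
  rw [Real.logb_le_iff_le_rpow h1 hn0, Real.rpow_natCast, one_div_pow] at h2
  exact h2

lemma phases_le {n : ℕ} (hn : 2 ≤ n) {η : ℝ} (hη : 0 < η) (hη' : η < 1) :
    (phases n η : ℝ) ≤ (1 / Real.log (1 / (1 - η)) + 2) * Real.log n := by
  have h1 := one_lt_one_div_one_sub hη hη'
  have h2 : 0 ≤ Real.logb (1 / (1 - η)) n :=
    (Real.logb_pos h1 (by exact_mod_cast hn)).le
  have h3 := (Nat.ceil_lt_add_one h2).le
  have h4 := half_lt_log hn
  have h5 : Real.logb (1 / (1 - η)) n = 1 / Real.log (1 / (1 - η)) * Real.log n := by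
    rw [Real.logb]; ring
  have h6 : (phases n η : ℝ) ≤ Real.logb (1 / (1 - η)) n + 1 := h3
  rw [h5] at h6
  linarith

lemma eps0_pos {n : ℕ} (hn : 2 ≤ n) {η ε : ℝ} (hη : 0 < η) (hη' : η < 1) (hε : 0 < ε) :
    0 < eps0 n η ε := by
  have : (0 : ℝ) < phases n η := by exact_mod_cast phases_pos hn hη hη'
  unfold eps0; positivity

lemma manisEps_pos {n : ℕ} (hn : 2 ≤ n) {C₁ ε : ℝ} (hC₁ : 0 < C₁) (hε : 0 < ε) :
    0 < manisEps n C₁ ε := by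
  have := half_lt_log hn
  unfold manisEps
  exact div_pos hε (mul_pos hC₁ (by linarith))

lemma isProbabilityMeasure_coverLaw (m : ℕ) {n : ℕ} (hn : 2 ≤ n) {η C₁ ε : ℝ} (C₂ : ℝ)
    (hη : 0 < η) (hη' : η < 1) (hC₁ : 0 < C₁) (hε : 0 < ε) :
    IsProbabilityMeasure (coverLaw m n η C₁ C₂ ε) := by
  have h := eps0_pos hn hη hη' hε
  have := isProbabilityMeasure_phaseLaw m (manisRounds n C₂) h (manisEps_pos hn hC₁ h)
  rw [coverLaw_eq]; infer_instance

lemma exp_neg_mul_log {n : ℕ} (hn : 2 ≤ n) (j : ℕ) :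
    Real.exp (-((j : ℝ) * Real.log n)) = 1 / (n : ℝ) ^ j := by
  have hn0 : (0 : ℝ) < n := by positivity
  rw [Real.exp_neg, Real.exp_nat_mul, Real.exp_log hn0, one_div]

lemma one_sub_pow_manisRounds_le {n : ℕ} (hn : 2 ≤ n) {c C₂ : ℝ} (hc : 0 < c) (hc' : c < 1) (j : ℕ)
    (hC₂ : j / c ≤ C₂) : (1 - c) ^ manisRounds n C₂ ≤ 1 / (n : ℝ) ^ j := by
  have hlog := half_lt_log hn
  rw [← exp_neg_mul_log hn]
  calc (1 - c) ^ manisRounds n C₂ ≤ Real.exp (-c) ^ manisRounds n C₂ :=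
        pow_le_pow_left₀ (by linarith) (Real.one_sub_le_exp_neg c) _
    _ = Real.exp (manisRounds n C₂ * -c) := (Real.exp_nat_mul _ _).symm
    _ ≤ _ := by
      refine Real.exp_le_exp.2 ?_
      have h1 : C₂ * Real.log n ≤ manisRounds n C₂ := by
        have := Nat.le_ceil (C₂ * Real.log n)
        unfold manisRounds
        push_cast
        linarith
      have h2 : (j : ℝ) ≤ C₂ * c := (div_le_iff₀ hc).1 hC₂
      have h3 : (j : ℝ) * Real.log n ≤ C₂ * c * Real.log n :=
        mul_le_mul_of_nonneg_right h2 (by linarith)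
      nlinarith

lemma manisRounds_le {n : ℕ} (hn : 2 ≤ n) {C₂ : ℝ} (hC₂ : 0 ≤ C₂) :
    (manisRounds n C₂ : ℝ) ≤ (C₂ + 4) * Real.log n := by
  have hlog := half_lt_log hn
  have := (Nat.ceil_lt_add_one (by positivity : 0 ≤ C₂ * Real.log n)).le
  unfold manisRounds
  push_cast
  linarith

/-- The union bound over all phases, in terms of `n`. -/
lemma failure_bound {n N m k R T : ℕ} (hn : 2 ≤ n) (hN : N ≤ n) (hm : m ≤ n ^ k) {c a b : ℝ}
    (hc : c ≤ 1) (hR : (1 - c) ^ R ≤ 1 / (n : ℝ) ^ (k + 3)) (hTa : (T : ℝ) ≤ a * Real.log n)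
    (hRb : (R : ℝ) ≤ b * Real.log n) (ha : 0 ≤ a) :
    (T : ENNReal) * ((m * (2 + 2 * R) : ℕ) *
        ENNReal.ofReal (Real.exp (-(((k + 2 : ℕ) : ℝ) * Real.log n)))) +
      T * (ENNReal.ofReal (1 - c) ^ R * (m * N : ℕ)) ≤
      ENNReal.ofReal (a * (6 + 2 * b) * Real.log n ^ 2 / (n : ℝ) ^ 2) := by
  have hlog := half_lt_log hn
  have hn0 : (0 : ℝ) < n := by positivity
  have hc0 : 0 ≤ 1 - c := by linarith
  have hmr : (m : ℝ) ≤ (n : ℝ) ^ k := by exact_mod_cast hm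
  have hNr : (N : ℝ) ≤ n := by exact_mod_cast hN
  rw [exp_neg_mul_log hn, ← ENNReal.ofReal_pow hc0, ← ENNReal.ofReal_natCast,
    ← ENNReal.ofReal_natCast, ← ENNReal.ofReal_natCast, ← ENNReal.ofReal_mul (by positivity),
    ← ENNReal.ofReal_mul (by positivity), ← ENNReal.ofReal_mul (by positivity),
    ← ENNReal.ofReal_mul (by positivity), ← ENNReal.ofReal_add (by positivity) (by positivity)]
  refine ENNReal.ofReal_le_ofReal ?_
  have h1 : ((m * (2 + 2 * R) : ℕ) : ℝ) * (1 / (n : ℝ) ^ (k + 2)) ≤ (2 + 2 * R) / (n : ℝ) ^ 2 := by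
    push_cast
    calc (m : ℝ) * (2 + 2 * R) * (1 / (n : ℝ) ^ (k + 2))
        ≤ (n : ℝ) ^ k * (2 + 2 * R) * (1 / (n : ℝ) ^ (k + 2)) := by gcongr
      _ = (2 + 2 * R) / (n : ℝ) ^ 2 := by rw [pow_add]; field_simp
  -- There are at most `n^(k+1)` edges, so decay to `n^(-(k+3))` leaves `n^(-2)`.
  have h2 : (1 - c) ^ R * ((m * N : ℕ) : ℝ) ≤ 1 / (n : ℝ) ^ 2 := by
    push_cast
    calc (1 - c) ^ R * ((m : ℝ) * N) ≤ 1 / (n : ℝ) ^ (k + 3) * ((n : ℝ) ^ k * n) := by gcongr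
      _ = 1 / (n : ℝ) ^ 2 := by rw [pow_add]; field_simp
  have h3 : (3 + 2 * R : ℝ) ≤ (6 + 2 * b) * Real.log n := by linarith
  calc (T : ℝ) * (((m * (2 + 2 * R) : ℕ) : ℝ) * (1 / (n : ℝ) ^ (k + 2))) +
        T * ((1 - c) ^ R * ((m * N : ℕ) : ℝ))
      ≤ T * ((2 + 2 * R) / (n : ℝ) ^ 2) + T * (1 / (n : ℝ) ^ 2) := by gcongr
    _ = T * (3 + 2 * R) / (n : ℝ) ^ 2 := by ring
    _ ≤ (a * Real.log n) * ((6 + 2 * b) * Real.log n) / (n : ℝ) ^ 2 := by gcongr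
    _ = _ := by ring

lemma one_sub_le_of_compl_le {α : Type*} [MeasurableSpace α] (μ : Measure α)
    [IsProbabilityMeasure μ] {G : Set α} {p : ENNReal} (h : μ Gᶜ ≤ p) : 1 - p ≤ μ G := by
  rw [tsub_le_iff_right, ← measure_univ (μ := μ)]
  exact (measure_univ_le_add_compl G).trans (add_le_add_right h _)

end DPCover

/-! ### The main theorem: choice of constants -/

open DPCover in
theorem mainTheorem7 (η : ℝ) (hη₀ : 0 < η) (hη₁ : η < 1 / 3) (k : ℕ) :
    ∃ C₂min : ℝ, ∀ C₂ : ℝ, C₂min ≤ C₂ → ∀ C₁ : ℝ, 0 < C₁ →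
    ∃ Kmin : ℝ, ∀ K : ℝ, Kmin ≤ K →
    ∃ (c C : ℝ) (d : ℕ), 0 < c ∧ 0 < C ∧
    ∀ (n N m : ℕ), 2 ≤ n → N ≤ n → m ≤ n ^ k →
    ∀ (S : Fin m → Finset (Fin N)) (ε : ℝ), 0 < ε →
    1 - ENNReal.ofReal (C * Real.log n ^ d / (n : ℝ) ^ 2) ≤
      DPCover.coverLaw m n η C₁ C₂ ε
        {ω | (DPCover.coverOutput S n η C₁ K ε ω).Perm (List.finRange m) ∧
          DPCover.IsPrefixOptimal S (1 - 5 * η)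
            (c * Real.log n ^ 2 / DPCover.eps0 n η ε) (DPCover.coverOutput S n η C₁ K ε ω) ∧
          ∀ (i : ℕ) (hi : i < (DPCover.coverOutput S n η C₁ K ε ω).length) (g : Fin m),
            DPCover.IsGreedyChoice S ((DPCover.coverOutput S n η C₁ K ε ω).take i) g →
            (DPCover.newCoverage S ((DPCover.coverOutput S n η C₁ K ε ω).take i)
                (DPCover.coverOutput S n η C₁ K ε ω)[i] : ℝ) ≥
              (1 - 5 * η) *
                (DPCover.newCoverage S ((DPCover.coverOutput S n η C₁ K ε ω).take i) g : ℝ) -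
              c * Real.log n ^ 2 / DPCover.eps0 n η ε} := by
  have hη1 : η < 1 := by linarith
  rcases lt_or_ge η (1 / 5) with hη5 | hη5
  · have hdp := decayRate_pos hη₀ (by linarith : η < 1 / 4)
    have hdl := decayRate_lt_one hη₀ (by linarith : η < 1 / 4)
    refine ⟨((k + 3 : ℕ) : ℝ) / decayRate η, fun C₂ hC₂ C₁ hC₁ => ?_⟩
    have hC₂0 : 0 ≤ C₂ := le_trans (by positivity) hC₂
    -- The noise bound is `z = M L` with `L = log² n / ε₀`. The summands of `M` cover the bucket
    -- noise (`2(k+2)`, from `log n ≤ 2 log² n`), the noise inside the calls (`2(k+2) C₁`) and the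
    -- survival offset (`15 C₁`, as `1 - 3η > 2/5`).
    set M : ℝ := 2 * ((k + 2 : ℕ) : ℝ) * (1 + C₁) + 15 * C₁ with hM
    have hM0 : 0 < M := by positivity
    -- The invariant error is `w = c₀ L`, chosen so that `3z = ηw`.
    set c₀ : ℝ := 3 * M / η with hc₀
    have hc₀0 : 0 < c₀ := by positivity
    -- This makes the bucket slack `K L` at least `w + z`.
    refine ⟨c₀ + M, fun K hK => ?_⟩
    have hlη : 0 < Real.log (1 / (1 - η)) := Real.log_pos (one_lt_one_div_one_sub hη₀ hη1)
    set a : ℝ := 1 / Real.log (1 / (1 - η)) + 2 with ha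
    have ha0 : 0 < a := by positivity
    have hK0 : 0 ≤ K := by linarith
    -- Dominates both the loss `w + K L + 3z` within a phase and the loss `5w` of the leftover sets.
    refine ⟨5 * c₀ + K + 3 * M, a * (6 + 2 * (C₂ + 4)), 2, by positivity, by positivity, ?_⟩
    intro n N m hn hN hm S ε hε
    have hE := eps0_pos hn hη₀ hη1 hε
    have hδ := manisEps_pos hn hC₁ hE
    have hlog := half_lt_log hn
    have hlog0 : 0 < Real.log n := by linarith
    have := isProbabilityMeasure_coverLaw m hn C₂ hη₀ hη1 hC₁ hε
    set E := eps0 n η ε with hEdef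
    set L : ℝ := Real.log n ^ 2 / E with hL
    have hL0 : 0 < L := by positivity
    have hlogL : Real.log n / E ≤ 2 * L := by
      rw [hL, ← mul_div_assoc]
      exact div_le_div_of_nonneg_right (by nlinarith) hE.le
    have hso : survivalOffset n η C₁ ε = 6 * C₁ / (1 - 3 * η) * L := by
      have : (1 - 3 * η) ≠ 0 := by linarith
      rw [survivalOffset, ← hEdef, manisEps, hL]
      field_simp
    have h35 : 6 * C₁ / (1 - 3 * η) ≤ 15 * C₁ := by
      rw [div_le_iff₀ (by linarith)]; nlinarith
    have hθ0 : 0 ≤ survivalOffset n η C₁ ε := by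
      have : 0 < 1 - 3 * η := by linarith
      rw [hso]; positivity
    have hθ : survivalOffset n η C₁ ε ≤ M * L := by
      rw [hso]
      refine mul_le_mul_of_nonneg_right (h35.trans ?_) hL0.le
      rw [hM]
      have : 0 ≤ 2 * ((k + 2 : ℕ) : ℝ) * (1 + C₁) := by positivity
      linarith
    -- Each noise value fails with probability `n^(-(k+2))`; the at most `n^k` sets leave `n^(-2)`
    -- up to logarithms.
    set u : ℝ := ((k + 2 : ℕ) : ℝ) * Real.log n with hu
    have hu0 : 0 ≤ u := by positivity
    have hz1 : u / E ≤ M * L := by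
      calc u / E = ((k + 2 : ℕ) : ℝ) * (Real.log n / E) := by rw [hu]; ring
        _ ≤ ((k + 2 : ℕ) : ℝ) * (2 * L) := by gcongr
        _ = 2 * ((k + 2 : ℕ) : ℝ) * L := by ring
        _ ≤ M * L := by
          refine mul_le_mul_of_nonneg_right ?_ hL0.le
          rw [hM]
          have : 0 ≤ 2 * ((k + 2 : ℕ) : ℝ) * C₁ := by positivity
          linarith
    have hz2 : 2 * u / manisEps n C₁ E ≤ M * L := by
      calc 2 * u / manisEps n C₁ E = 2 * ((k + 2 : ℕ) : ℝ) * C₁ * L := by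
            rw [hu, manisEps, hL]; field_simp
        _ ≤ M * L := by
          refine mul_le_mul_of_nonneg_right ?_ hL0.le
          rw [hM]
          have : 0 ≤ 2 * ((k + 2 : ℕ) : ℝ) := by positivity
          linarith
    have hκL : K * Real.log n ^ 2 / E = K * L := by rw [hL]; ring
    have hvL : (5 * c₀ + K + 3 * M) * Real.log n ^ 2 / E = (5 * c₀ + K + 3 * M) * L := by
      rw [hL]; ring
    refine one_sub_le_of_compl_le _ (le_trans (measure_mono ?_) ((measure_not_goodDraws_le
      (T := phases n η) (R := manisRounds n C₂) (K := K) S n hE hδ hη₀ (by linarith) hθ0 hu0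
      hz1 hz2).trans ?_))
    · intro ω hω hgood
      have hNT : (N : ℝ) ≤ 1 / (1 - η) ^ phases n η :=
        le_trans (by exact_mod_cast hN) (le_one_div_pow_phases hn hη₀ hη1)
      have hall : PrefixAll (NearGreedy S η ((5 * c₀ + K + 3 * M) * Real.log n ^ 2 / E))
          (coverOutput S n η C₁ K ε ω) := by
        refine coverOutput_prefixAll (w := c₀ * L) hη₀ hη5 hgood hθ (by positivity) (by positivity)
          ?_ ?_ hNT (phases_pos hn hη₀ hη1) ?_ ?_
        · refine le_of_eq ?_
          rw [hc₀]; field_simp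
        · rw [← hEdef, hκL, ← add_mul]
          exact mul_le_mul_of_nonneg_right hK hL0.le
        · rw [← hEdef, hκL, hvL]
          linarith [mul_pos hc₀0 hL0]
        · rw [hvL]
          linarith [mul_pos hM0 hL0, mul_nonneg hK0 hL0.le]
      exact hω ⟨perm_coverOutput S n η C₁ K ε ω, hall.isPrefixOptimal,
        fun i hi g _ => hall.getElem i hi g⟩
    · exact failure_bound hn hN hm hdl.le
        (one_sub_pow_manisRounds_le hn hdp hdl (k + 3) hC₂) (phases_le hn hη₀ hη1)
        (manisRounds_le hn hC₂0) ha0.le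
  -- Here `1 - 5η ≤ 0`, so the claim holds for every tape and any positive constants.
  · refine ⟨0, fun C₂ _ C₁ hC₁ => ⟨0, fun K _ => ⟨1, 1, 0, one_pos, one_pos, ?_⟩⟩⟩
    intro n N m hn hN hm S ε hε
    have hE := eps0_pos hn hη₀ hη1 hε
    have := isProbabilityMeasure_coverLaw m hn C₂ hη₀ hη1 hC₁ hε
    refine one_sub_le_of_compl_le _ (le_trans (le_of_eq ?_) zero_le)
    rw [← measure_empty (μ := coverLaw m n η C₁ C₂ ε)]
    congr 1
    rw [Set.compl_empty_iff, Set.eq_univ_iff_forall]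
    intro ω
    have hall : PrefixAll (NearGreedy S η (1 * Real.log n ^ 2 / eps0 n η ε))
        (coverOutput S n η C₁ K ε ω) := by
      intro P a Q _ g
      have h1 : (0 : ℝ) ≤ newCoverage S P g := Nat.cast_nonneg _
      have h2 : (0 : ℝ) ≤ newCoverage S P a := Nat.cast_nonneg _
      have h3 : 0 ≤ 1 * Real.log n ^ 2 / eps0 n η ε := by positivity
      nlinarith
    exact ⟨perm_coverOutput S n η C₁ K ε ω, hall.isPrefixOptimal,
      fun i hi g _ => hall.getElem i hi g⟩
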